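/- Notation. For $d\ge 1$ and $0\le j<d$ let $$E(d,j)=\langle \alpha,\beta,\gamma : \alpha^d=\beta^d=\gamma^j,\ \gamma^d=[\alpha,\gamma]=[\beta,\gamma]=1,\ [\alpha,\beta]=\gamma\rangle,$$ where $[g,h]=g^{-1}h^{-1}gh$. For $m,d\ge 1$ let $\mathcal A_{m,d}$ be the class of finite abelian groups whose minimal number of generators is $m$ and which contain an element of order $d$. For an isomorphism $\varphi:D_1\to D_2$ between central subgroups $D_i\le Z(G_i)$, the central product is $G_1\curlywedge_\varphi G_2=(G_1\times G_2)/\{(z,\varphi(z)^{-1}): z\in D_1\}$; $\varphi$ is maximal if no isomorphism between central subgroups of $G_1$ and $G_2$ properly extends it. For $n,m\ge 1$ let $\mathcal S_{n,m}$ be the class of finite groups isomorphic to $(\cdots((E_1\curlywedge_{\varphi_1} E_2)\curlywedge_{\varphi_2}\cdots)\curlywedge_{\varphi_{n-1}} E_n)\curlywedge_{\varphi_n}A$, where for some $d\ge 1$ each $E_k$ is $E(d,j_k)$ with $0\le j_k<d$, $A\in\mathcal A_{m,d}$, and each $\varphi_k$ is a maximal central isomorphism between cyclic subgroups of order $d$.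 For a prime $p$, a finite $p$-group $S$ is special if it is elementary abelian, or if $\Phi(S)=Z(S)=[S,S]$ and this subgroup is elementary abelian; it is extra-special if moreover it is non-abelian with cyclic centre. Lemma 2.9. Let $p$ be a prime, $r\ge 1$, and let $S$ be a special $p$-group of order $p^r$. (1) $S$ is isomorphic to a subgroup of a direct product $G_1\times\cdots\times G_r$ in which each $G_i$ belongs to $\mathcal S_{n,m}$ for some $n,m\ge1$ (depending on $i$) with $2n+m\le\max(r,3)$. (2) Suppose that $S$ is non-abelian and $|Z(S)|=p^s$. Then there are subgroups $K_1,\dots,K_s\le Z(S)$ with $K_1\cap\dots\cap K_s=1$ (so that $S$ embeds in $\prod_{i=1}^s S/K_i$) such that for each $i$ there are $n,m\ge 1$ with $2n+m\le r$ for which $S/K_i\in\mathcal S_{n,m}$; more precisely, $S/K_i$ is an iterated central product as above, with $d=p$, of groups $E_1,\dots,E_n\in\{E(p,0),E(p,1)\}$, each extra-special of order $p^3$, and a group $A\in\mathcal A_{m,p}$ with $A\cong \mathbb Z_p^m$ or $A\cong\mathbb Z_p^{m-1}\times\mathbb Z_{p^2}$. -/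

import Mathlib

namespace SpecialGroups

/-- Elementary abelian `p`-groups. -/
def IsElementaryAbelian (p : ℕ) (H : Type*) [Group H] : Prop :=
  (∀ x y : H, x * y = y * x) ∧ ∀ x : H, x ^ p = 1

/-- A finite `p`-group is special if it is elementary abelian, or if its Frattini subgroup, centre
and commutator subgroup coincide and are elementary abelian. -/
def IsSpecial (p : ℕ) (S : Type*) [Group S] : Prop :=
  Finite S ∧ IsPGroup p S ∧
    (IsElementaryAbelian p S ∨
      (frattini S = Subgroup.center S ∧ Subgroup.center S = commutator S ∧
        IsElementaryAbelian p (frattini S)))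

/-- A non-abelian special `p`-group with cyclic centre. -/
def IsExtraSpecial (p : ℕ) (S : Type*) [Group S] : Prop :=
  IsSpecial p S ∧ (¬ ∀ x y : S, x * y = y * x) ∧ IsCyclic (Subgroup.center S)

/-- The commutator in the convention `[g, h] = g⁻¹ h⁻¹ g h`. -/
def groupComm {G : Type*} [Group G] (g h : G) : G := g⁻¹ * h⁻¹ * g * h

/-- The three generators of the groups `E d j`. -/
inductive Gen : Type
  | α
  | β
  | γ

/-- The relators of
`⟨α, β, γ : α ^ d = β ^ d = γ ^ j, γ ^ d = [α, γ] = [β, γ] = 1, [α, β] = γ⟩`. -/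
def relators (d j : ℕ) : Set (FreeGroup Gen) :=
  let a := FreeGroup.of Gen.α
  let b := FreeGroup.of Gen.β
  let c := FreeGroup.of Gen.γ
  {a ^ d * (c ^ j)⁻¹, b ^ d * (c ^ j)⁻¹, c ^ d, groupComm a c, groupComm b c, groupComm a b * c⁻¹}

/-- The group `E(d, j)`. -/
abbrev E (d j : ℕ) : Type := PresentedGroup (relators d j)

/-- `A` belongs to `𝒜_{m,d}`: a finite abelian group whose minimal number of generators is `m` and
which has an element of order `d`. -/
def MemA (m d : ℕ) (A : Type*) [CommGroup A] : Prop :=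
  ∃ _ : Finite A, Group.rank A = m ∧ ∃ a : A, orderOf a = d

/-- An isomorphism between central subgroups of `G₁` and `G₂`. -/
structure CentralIso (G₁ G₂ : Type*) [Group G₁] [Group G₂] where
  source : Subgroup G₁
  target : Subgroup G₂
  source_le : source ≤ Subgroup.center G₁
  target_le : target ≤ Subgroup.center G₂
  equiv : source ≃* target

namespace CentralIso

variable {G₁ G₂ : Type*} [Group G₁] [Group G₂]

/-- `ψ` extends `φ`. -/
def Extends (ψ φ : CentralIso G₁ G₂) : Prop :=
  ∃ h : φ.source ≤ ψ.source,
    ∀ z : φ.source, (ψ.equiv (Subgroup.inclusion h z) : G₂) = φ.equiv z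

/-- The only isomorphism between central subgroups extending `φ` is `φ` itself. -/
def IsMaximal (φ : CentralIso G₁ G₂) : Prop :=
  ∀ ψ : CentralIso G₁ G₂, ψ.Extends φ → ψ = φ

/-- The subgroup `{(z, φ(z)⁻¹) : z ∈ D₁}` of `G₁ × G₂`. -/
def kernel (φ : CentralIso G₁ G₂) : Subgroup (G₁ × G₂) where
  carrier := {x | ∃ z : φ.source, x = ((z : G₁), ((φ.equiv z : G₂))⁻¹)}
  one_mem' := ⟨1, by simp [Prod.one_eq_mk]⟩
  mul_mem' := by
    rintro _ _ ⟨z, rfl⟩ ⟨w, rfl⟩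
    refine ⟨z * w, ?_⟩
    have h := Subgroup.mem_center_iff.1 (φ.target_le (φ.equiv z).2) ((φ.equiv w : G₂))
    simp only [Prod.mk_mul_mk, map_mul, Subgroup.coe_mul, Prod.mk.injEq, true_and]
    rw [← mul_inv_rev, h]
  inv_mem' := by
    rintro _ ⟨z, rfl⟩
    exact ⟨z⁻¹, by simp⟩

instance kernel_normal (φ : CentralIso G₁ G₂) : φ.kernel.Normal where
  conj_mem := by
    rintro _ ⟨z, rfl⟩ ⟨g, h⟩
    refine ⟨z, ?_⟩
    have h₁ := Subgroup.mem_center_iff.1 (φ.source_le z.2) g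
    have h₂ := Subgroup.mem_center_iff.1 (inv_mem (φ.target_le (φ.equiv z).2)) h
    simp only [Prod.mk_mul_mk, Prod.inv_mk, Prod.mk.injEq]
    rw [h₁, h₂]
    simp

/-- The external central product `G₁ ⋏_φ G₂`. -/
abbrev CentralProduct (φ : CentralIso G₁ G₂) := (G₁ × G₂) ⧸ φ.kernel

end CentralIso

/-- `H ≅ G₀ ⋏ G₁ ⋏ ⋯ ⋏ Gₖ` (bracketed to the left), where `l = [G₁, …, Gₖ]`, for some maximal
central isomorphisms, each of which identifies cyclic subgroups of order `d`. -/
def IsIteratedCentralProductFrom (d : ℕ) (H : Type*) [Group H] :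
    GrpCat.{0} → List GrpCat.{0} → Prop
  | G₀, [] => Nonempty (H ≃* G₀)
  | G₀, G₁ :: l => ∃ φ : CentralIso G₀ G₁, φ.IsMaximal ∧ IsCyclic φ.source ∧
      Nat.card φ.source = d ∧ IsIteratedCentralProductFrom d H (GrpCat.of φ.CentralProduct) l

/-- `H` is an iterated central product (in the above sense) of the groups in a list. The product of
the empty list, which is never used, is the trivial group. -/
def IsIteratedCentralProduct (d : ℕ) (H : Type*) [Group H] : List GrpCat.{0} → Prop
  | [] => Subsingleton H
  | G₀ :: l => IsIteratedCentralProductFrom d H G₀ l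

/-- The list `E(d, j₁), …, E(d, jₙ), A`. -/
def factorList (d : ℕ) {n : ℕ} (j : Fin n → ℕ) (A : Type) [CommGroup A] : List GrpCat.{0} :=
  List.ofFn (fun k => GrpCat.of (E d (j k))) ++ [GrpCat.of A]

/-- `G` belongs to `𝒮_{n,m}` (for positive `n` and `m`). -/
def MemS (n m : ℕ) (G : Type*) [Group G] : Prop :=
  Finite G ∧ ∃ d : ℕ, 0 < d ∧ ∃ j : Fin n → ℕ, (∀ k, j k < d) ∧
    ∃ (A : Type) (_ : CommGroup A), MemA m d A ∧
      IsIteratedCentralProduct d G (factorList d j A)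

/-- `S` belongs to `𝒮_I^r`: it embeds in a direct product of `r` groups from
`⋃_{(n,m) ∈ I} 𝒮_{n,m}`. -/
def MemSProd (I : Set (ℕ × ℕ)) (r : ℕ) (S : Type*) [Group S] : Prop :=
  ∃ G : Fin r → GrpCat.{0}, (∀ i, ∃ nm ∈ I, MemS nm.1 nm.2 (G i)) ∧
    ∃ f : S →* (∀ i, G i), Function.Injective f

end SpecialGroups

/-! Suppose `S` is non-abelian. Its centre equals `[S, S]` and is a vector space over `ZMod p`. The
kernels `K i` of a full set of coordinate functionals on the centre meet trivially. In `T = S ⧸ K i`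
the centre of `S` has an image of order `p`, generated by some `c`, and every commutator and every
`p`-th power in `T` is a power of `c` (`IsSpecial.exists_isCommutatorGenerator`).

Such a `T` splits in the way extra-special groups do. The commutator is an alternating form with
values in `⟨c⟩`. A non-commuting pair, after a change of generators, generates a copy of `E p 0` or
`E p 1` (`exists_isHeisenbergPair`). The form is nondegenerate on this copy modulo `⟨c⟩`, so `T` is
the product of the copy and its centralizer. The process is repeated in the centralizer until that
is abelian (`IsCommutatorGenerator.exists_iterated`). The abelian remainder has all its `p`-th
powers in `⟨c⟩`, so at most one cyclic factor has order `p ^ 2` and the others have order `p`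
(`exists_memA`). Each partial product of the `E`s has centre `⟨c⟩`, so gluing along `⟨c⟩` is maximal
and the internal products are the required external ones (`exists_centralIso`). Each `E` accounts
for a factor `p ^ 2` of the order and the remainder for at least `p ^ m`, whence `2 * n + m ≤ r`.

If `S` is abelian, each coordinate maps it into the centre of `E p 0`. That group has order `p ^ 3`,
so its own decomposition satisfies `2 * n + m ≤ 3`. -/

namespace SpecialGroups

/-! ### Commutator calculus modulo a central element, and Heisenberg pairs. -/

section Calculus

variable {G : Type*} [Group G]

/-- `x` and `y` commute up to the factor `c ^ i`. -/
def CommBy (c x y : G) (i : ℤ) : Prop := x * y = y * x * c ^ i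

variable {c x y x' y' : G} {i i' : ℤ}

/-- With `c` central, the exponent in `CommBy` is additive in each argument. This bilinearity
replaces explicit commutator identities throughout. -/
theorem CommBy.mul_left (hc : ∀ g, Commute c g) (h : CommBy c x y i) (h' : CommBy c x' y i') :
    CommBy c (x * x') y (i + i') := by
  unfold CommBy at *
  have hi : c ^ i * (x' * c ^ i') = x' * c ^ (i + i') := by
    rw [← mul_assoc, ((hc x').zpow_left i).eq, mul_assoc, zpow_add]
  calc x * x' * y = x * y * x' * c ^ i' := by rw [mul_assoc, h']; group
    _ = y * x * (c ^ i * (x' * c ^ i')) := by rw [h]; group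
    _ = y * (x * x') * c ^ (i + i') := by rw [hi]; group

theorem CommBy.symm (h : CommBy c x y i) : CommBy c y x (-i) := by
  unfold CommBy at *
  rw [h]; group

theorem CommBy.mul_right (hc : ∀ g, Commute c g) (h : CommBy c x y i) (h' : CommBy c x y' i') :
    CommBy c x (y * y') (i + i') := by
  have := (h.symm.mul_left hc h'.symm).symm
  rwa [neg_add, neg_neg, neg_neg] at this

theorem CommBy.of_commute (h : Commute x y) : CommBy c x y 0 := by
  simpa [CommBy] using h.eq

theorem CommBy.commute (h : CommBy c x y 0) : Commute x y := by
  simpa [CommBy, Commute, SemiconjBy] using h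

theorem CommBy.inv_left (hc : ∀ g, Commute c g) (h : CommBy c x y i) :
    CommBy c x⁻¹ y (-i) := by
  unfold CommBy at *
  have hi : x⁻¹ * c ^ (-i) = c ^ (-i) * x⁻¹ := (((hc x⁻¹).zpow_left (-i)).eq).symm
  have h2 : y = x⁻¹ * (y * x * c ^ i) := by rw [← h]; group
  calc x⁻¹ * y = x⁻¹ * (y * x * c ^ i) * c ^ (-i) * x⁻¹ := by group
    _ = y * (c ^ (-i) * x⁻¹) := by rw [← h2]; group
    _ = y * x⁻¹ * c ^ (-i) := by rw [← hi]; group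

theorem CommBy.pow_left (hc : ∀ g, Commute c g) (h : CommBy c x y i) (n : ℕ) :
    CommBy c (x ^ n) y (n * i) := by
  induction n with
  | zero => simpa using CommBy.of_commute (c := c) (Commute.one_left y)
  | succ n ih =>
    rw [pow_succ]
    convert ih.mul_left hc h using 1
    push_cast; ring

theorem CommBy.zpow_left (hc : ∀ g, Commute c g) (h : CommBy c x y i) (n : ℤ) :
    CommBy c (x ^ n) y (n * i) := by
  obtain ⟨n, rfl | rfl⟩ := n.eq_nat_or_neg
  · simpa using h.pow_left hc n
  · simpa using (h.pow_left hc n).inv_left hc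

theorem CommBy.zpow_right (hc : ∀ g, Commute c g) (h : CommBy c x y i) (n : ℤ) :
    CommBy c x (y ^ n) (n * i) := by
  have := (h.symm.zpow_left hc n).symm
  rwa [mul_neg, neg_neg] at this

theorem CommBy.zpow_eq (h : CommBy c x y i) (h' : CommBy c x y i') : c ^ i = c ^ i' := by
  unfold CommBy at *
  exact mul_left_cancel (h.symm.trans h')

/-- Sorting `(x * y) ^ n` moves `y` past `x` exactly `n.choose 2` times, and each move costs `c ^
(-i)`. For odd `p` and `n = p` the correction vanishes when `c ^ p = 1`; for `p = 2` it does not. -/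
theorem CommBy.mul_pow (hc : ∀ g, Commute c g) (h : CommBy c x y i) (n : ℕ) :
    (x * y) ^ n = x ^ n * y ^ n * c ^ (-(i * n.choose 2)) := by
  induction n with
  | zero => simp
  | succ n ih =>
    have h1 : y ^ n * x = x * y ^ n * c ^ (n * -i) := h.symm.pow_left hc n
    set e := -(i * (n.choose 2 : ℤ))
    have h2 : -(i * ((n + 1).choose 2 : ℤ)) = n * -i + e := by
      simp only [Nat.choose_succ_succ', Nat.reduceAdd, Nat.choose_one_right, e]
      push_cast; ring
    have h3 : ∀ k : ℤ, ∀ g, c ^ k * g = g * c ^ k := fun k g => ((hc g).zpow_left k).eq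
    calc (x * y) ^ (n + 1) = x ^ n * y ^ n * (c ^ e * (x * y)) := by rw [pow_succ, ih]; group
      _ = x ^ n * (y ^ n * x) * y * c ^ e := by rw [h3]; group
      _ = x ^ n * x * y ^ n * (c ^ (n * -i) * y) * c ^ e := by rw [h1]; group
      _ = x ^ (n + 1) * y ^ (n + 1) * c ^ (-(i * ((n + 1).choose 2 : ℤ))) := by
        rw [h3, h2, zpow_add, pow_succ, pow_succ]; group

theorem zpow_eq_one_iff_dvd_of_prime {p : ℕ} (hp : p.Prime) (hcp : c ^ p = 1) (h1 : c ≠ 1)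
    (i : ℤ) : c ^ i = 1 ↔ (p : ℤ) ∣ i := by
  have := Fact.mk hp
  rw [← orderOf_eq_prime hcp h1, orderOf_dvd_iff_zpow_eq_one]

theorem mem_zpowers_of_ne_one {p : ℕ} (hp : p.Prime) (hcp : c ^ p = 1)
    (hx : x ∈ Subgroup.zpowers c) (hx1 : x ≠ 1) : c ∈ Subgroup.zpowers x := by
  obtain ⟨n, rfl⟩ := hx
  dsimp only at hx1 ⊢
  have hn : ¬ (p : ℤ) ∣ n := by
    rintro ⟨t, rfl⟩
    rw [zpow_mul, zpow_natCast, hcp, one_zpow] at hx1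
    exact hx1 rfl
  obtain ⟨u, v, huv⟩ := ((Nat.prime_iff_prime_int.1 hp).coprime_iff_not_dvd.2 hn).symm
  refine ⟨u, ?_⟩
  dsimp only
  rw [← zpow_mul]
  have h : n * u = 1 - p * v := by linear_combination huv
  rw [h, zpow_sub, zpow_mul, zpow_natCast, hcp, one_zpow, inv_one, mul_one, zpow_one]

/-- A pair `a, b` with commutator `c` satisfying the relations of `E p j`. -/
structure IsHeisenbergPair (p j : ℕ) (a b c : G) : Prop where
  central : ∀ g, Commute c g
  pow_eq_one : c ^ p = 1
  ne_one : c ≠ 1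
  commBy : CommBy c a b 1
  left_pow : a ^ p = c ^ j
  right_pow : b ^ p = c ^ j

/-- The aim is to make both `p`-th powers equal to the same `c' ^ j` with `j ≤ 1`. For odd `p` the
`p`-th power map is multiplicative on `⟨a, b⟩`, so this is linear algebra in the exponents; the
commutator may change to another generator of `⟨c⟩`. For `p = 2` the correction term in
`CommBy.mul_pow` is used to kill an unwanted square. -/
theorem exists_isHeisenbergPair {p : ℕ} (hp : p.Prime) {a b c : G} (hc : ∀ g, Commute c g)
    (hcp : c ^ p = 1) (h1 : c ≠ 1) (hab : CommBy c a b 1) {u v : ℤ} (ha : a ^ p = c ^ u)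
    (hb : b ^ p = c ^ v) :
    ∃ a' ∈ Subgroup.closure {a, b}, ∃ b' ∈ Subgroup.closure {a, b}, ∃ c' ∈ Subgroup.zpowers c,
      ∃ j, (j = 0 ∨ j = 1) ∧ IsHeisenbergPair p j a' b' c' := by
  have hma : a ∈ Subgroup.closure {a, b} := Subgroup.subset_closure (by simp)
  have hmb : b ∈ Subgroup.closure {a, b} := Subgroup.subset_closure (by simp)
  by_cases hu : c ^ u = 1
  · by_cases hv : c ^ v = 1
    · exact ⟨a, hma, b, hmb, c, Subgroup.mem_zpowers c, 0, Or.inl rfl, hc, hcp, h1, hab,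
        by simp [ha, hu], by simp [hb, hv]⟩
    rcases hp.eq_two_or_odd' with rfl | hodd
    -- Here `a ^ 2 = 1` and `b ^ 2 = c`, so `(a * b) ^ 2 = c * c⁻¹ = 1`.
    · refine ⟨a, hma, a * b, mul_mem hma hmb, c, Subgroup.mem_zpowers c, 0, Or.inl rfl, hc, hcp, h1,
        ?_, by simp [ha, hu], ?_⟩
      · simpa using (CommBy.of_commute (c := c) (Commute.refl a)).mul_right hc hab
      · have hv1 : ¬ (2 : ℤ) ∣ v := fun h =>
          hv ((zpow_eq_one_iff_dvd_of_prime hp hcp h1 v).2 (by exact_mod_cast h))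
        rw [hab.mul_pow hc, ha, hu, hb, one_mul, ← zpow_add, pow_zero,
          zpow_eq_one_iff_dvd_of_prime hp hcp h1]
        simp only [Nat.choose_self]; push_cast; omega
    · have hch : ∀ t : ℤ, c ^ (-(t * (p.choose 2 : ℤ))) = 1 := fun t => by
        rw [zpow_eq_one_iff_dvd_of_prime hp hcp h1, dvd_neg]
        refine Dvd.dvd.mul_left ?_ t
        exact_mod_cast hp.dvd_choose_self (by norm_num)
          (lt_of_le_of_ne hp.two_le (by rintro rfl; exact absurd hodd (by decide)))
      -- The exponent `1 - u` is chosen so that the `p`-th power of `a ^ v * b ^ (1 - u)` is `c ^ (u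
      -- * v + v * (1 - u)) = c ^ v`. This equals `b ^ p` and also the new commutator, so `j = 1`.
      have hcm := ((hab.zpow_left hc v).mul_left hc
        ((CommBy.of_commute (c := c) (Commute.refl b)).zpow_left hc (1 - u)))
      refine ⟨a ^ v * b ^ (1 - u), mul_mem (zpow_mem hma _) (zpow_mem hmb _), b, hmb, c ^ v,
        Subgroup.zpow_mem_zpowers c v, 1, Or.inr rfl, fun g => (hc g).zpow_left v, ?_, hv, ?_, ?_,
        ?_⟩
      · rw [← zpow_natCast, zpow_comm, zpow_natCast, hcp, one_zpow]
      · unfold CommBy at hcm ⊢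
        rw [hcm, zpow_one]; congr 2; ring
      · rw [((hab.zpow_left hc v).zpow_right hc (1 - u)).mul_pow hc, hch, mul_one,
          ← zpow_natCast, ← zpow_natCast, zpow_comm, zpow_comm b, zpow_natCast, zpow_natCast, ha,
          hb, ← zpow_mul, ← zpow_mul, ← zpow_add, pow_one]
        congr 1; ring
      · rw [hb, pow_one]
  · rcases hp.eq_two_or_odd' with rfl | hodd
    · have hu1 : ¬ (2 : ℤ) ∣ u := fun h =>
          hu ((zpow_eq_one_iff_dvd_of_prime hp hcp h1 u).2 (by exact_mod_cast h))
      have key : ∀ t : ℤ, ¬ (2 : ℤ) ∣ t → c ^ t = c := fun t ht => by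
        have : c ^ (t - 1) = 1 := (zpow_eq_one_iff_dvd_of_prime hp hcp h1 _).2 (by push_cast; omega)
        rw [← sub_add_cancel t 1, zpow_add, this, one_mul, zpow_one]
      by_cases hv : c ^ v = 1
      · refine ⟨a * b, mul_mem hma hmb, b, hmb, c, Subgroup.mem_zpowers c, 0, Or.inl rfl, hc, hcp,
          h1, ?_, ?_, by simp [hb, hv]⟩
        · simpa using hab.mul_left hc (CommBy.of_commute (c := c) (Commute.refl b))
        · rw [hab.mul_pow hc, ha, hb, hv, mul_one, ← zpow_add, pow_zero,
            zpow_eq_one_iff_dvd_of_prime hp hcp h1]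
          simp only [Nat.choose_self]; push_cast; omega
      · have hv1 : ¬ (2 : ℤ) ∣ v := fun h =>
          hv ((zpow_eq_one_iff_dvd_of_prime hp hcp h1 v).2 (by exact_mod_cast h))
        exact ⟨a, hma, b, hmb, c, Subgroup.mem_zpowers c, 1, Or.inr rfl, hc, hcp, h1, hab,
          by rw [ha, key u hu1, pow_one], by rw [hb, key v hv1, pow_one]⟩
    · have hch : ∀ t : ℤ, c ^ (-(t * (p.choose 2 : ℤ))) = 1 := fun t => by
        rw [zpow_eq_one_iff_dvd_of_prime hp hcp h1, dvd_neg]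
        refine Dvd.dvd.mul_left ?_ t
        exact_mod_cast hp.dvd_choose_self (by norm_num)
          (lt_of_le_of_ne hp.two_le (by rintro rfl; exact absurd hodd (by decide)))
      -- The mirror choice: `a ^ (1 - v) * b ^ u` has `p`-th power `c ^ u`, equal to `a ^ p` and to
      -- its commutator with `a`.
      have hcm := ((CommBy.of_commute (c := c) (Commute.refl a)).zpow_right hc (1 - v)).mul_right hc
        (hab.zpow_right hc u)
      refine ⟨a, hma, a ^ (1 - v) * b ^ u, mul_mem (zpow_mem hma _) (zpow_mem hmb _), c ^ u,
        Subgroup.zpow_mem_zpowers c u, 1, Or.inr rfl, fun g => (hc g).zpow_left u, ?_, hu, ?_, ?_,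
        ?_⟩
      · rw [← zpow_natCast, zpow_comm, zpow_natCast, hcp, one_zpow]
      · unfold CommBy at hcm ⊢
        rw [hcm, zpow_one]; congr 2; ring
      · rw [ha, pow_one]
      · rw [((hab.zpow_left hc (1 - v)).zpow_right hc u).mul_pow hc, hch, mul_one,
          ← zpow_natCast, ← zpow_natCast, zpow_comm, zpow_comm b, zpow_natCast, zpow_natCast, ha,
          hb, ← zpow_mul, ← zpow_mul, ← zpow_add, pow_one]
        congr 1; ring

theorem CommBy.exists_normal_form {a b : G} (hc : ∀ g, Commute c g) (hab : CommBy c a b 1)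
    (hx : x ∈ Subgroup.closure {a, b}) : ∃ i k l : ℤ, x = a ^ i * b ^ k * c ^ l := by
  have h3 : ∀ k : ℤ, ∀ g, c ^ k * g = g * c ^ k := fun k g => ((hc g).zpow_left k).eq
  have hba : ∀ i k : ℤ, b ^ k * a ^ i = a ^ i * b ^ k * c ^ (i * (k * -1)) := fun i k =>
    (hab.symm.zpow_left hc k).zpow_right hc i
  induction hx using Subgroup.closure_induction with
  | mem x hx =>
    rcases hx with rfl | rfl
    · exact ⟨1, 0, 0, by simp⟩
    · exact ⟨0, 1, 0, by simp⟩
  | one => exact ⟨0, 0, 0, by simp⟩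
  | mul x y _ _ hx hy =>
    obtain ⟨i, k, l, rfl⟩ := hx
    obtain ⟨i', k', l', rfl⟩ := hy
    refine ⟨i + i', k + k', i' * (k * -1) + l + l', ?_⟩
    calc _ = a ^ i * b ^ k * (c ^ l * (a ^ i' * b ^ k')) * c ^ l' := by group
      _ = a ^ i * (b ^ k * a ^ i') * b ^ k' * c ^ l * c ^ l' := by rw [h3]; group
      _ = a ^ i * a ^ i' * b ^ k * (c ^ (i' * (k * -1)) * b ^ k') * c ^ l * c ^ l' := by
        rw [hba]; group
      _ = _ := by rw [h3]; simp only [zpow_add, mul_assoc]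
  | inv x _ hx =>
    obtain ⟨i, k, l, rfl⟩ := hx
    refine ⟨-i, -k, -i * (-k * -1) + -l, ?_⟩
    calc _ = c ^ (-l) * (b ^ (-k) * a ^ (-i)) := by group
      _ = _ := by rw [hba, h3, mul_assoc, ← zpow_add]

namespace IsHeisenbergPair

variable {p j : ℕ} {a b : G}

theorem commBy_word (h : IsHeisenbergPair p j a b c) (i k l : ℤ) :
    CommBy c (a ^ i * b ^ k * c ^ l) b i ∧ CommBy c (a ^ i * b ^ k * c ^ l) a (-k) := by
  have hr : ∀ g, CommBy c (c ^ l) g 0 := fun g =>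
    CommBy.of_commute ((h.central g).zpow_left l)
  have hs : ∀ g, CommBy c g g 0 := fun g => CommBy.of_commute (Commute.refl g)
  constructor
  · simpa using ((h.commBy.zpow_left h.central i).mul_left h.central
      ((hs b).zpow_left h.central k)).mul_left h.central (hr b)
  · simpa using (((hs a).zpow_left h.central i).mul_left h.central
      (h.commBy.symm.zpow_left h.central k)).mul_left h.central (hr a)

theorem dvd_of_word_commute (h : IsHeisenbergPair p j a b c) (hp : p.Prime) {i k l : ℤ}
    (ha : Commute (a ^ i * b ^ k * c ^ l) a) (hb : Commute (a ^ i * b ^ k * c ^ l) b) :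
    (p : ℤ) ∣ i ∧ (p : ℤ) ∣ k := by
  have hw := h.commBy_word i k l
  have h1 := hw.1.zpow_eq (CommBy.of_commute hb)
  have h2 := hw.2.zpow_eq (CommBy.of_commute ha)
  rw [zpow_zero, zpow_eq_one_iff_dvd_of_prime hp h.pow_eq_one h.ne_one] at h1 h2
  exact ⟨h1, (dvd_neg.1 h2)⟩

theorem word_mem_zpowers (ha : a ^ p = c ^ j) (hb : b ^ p = c ^ j) {i k : ℤ} (hi : (p : ℤ) ∣ i)
    (hk : (p : ℤ) ∣ k) (l : ℤ) : a ^ i * b ^ k * c ^ l ∈ Subgroup.zpowers c := by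
  obtain ⟨i, rfl⟩ := hi
  obtain ⟨k, rfl⟩ := hk
  rw [zpow_mul, zpow_mul, zpow_natCast, zpow_natCast, ha, hb]
  exact mul_mem (mul_mem (zpow_mem (pow_mem (Subgroup.mem_zpowers c) _) _)
    (zpow_mem (pow_mem (Subgroup.mem_zpowers c) _) _)) (Subgroup.zpow_mem_zpowers c l)

theorem mem_zpowers_of_commute (h : IsHeisenbergPair p j a b c) (hp : p.Prime)
    (hx : x ∈ Subgroup.closure {a, b}) (ha : Commute x a) (hb : Commute x b) :
    x ∈ Subgroup.zpowers c := by
  obtain ⟨i, k, l, rfl⟩ := h.commBy.exists_normal_form h.central hx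
  have := h.dvd_of_word_commute hp ha hb
  exact word_mem_zpowers h.left_pow h.right_pow this.1 this.2 l

/-- Multiplication by a suitable element of `⟨a, b⟩` moves any element whose commutators with `a`
and `b` are powers of `c` into the centralizer of `a` and `b`. -/
theorem exists_commute (h : IsHeisenbergPair p j a b c) {s t : ℤ} (hs : CommBy c x a s)
    (ht : CommBy c x b t) :
    ∃ e ∈ Subgroup.closure {a, b}, ∃ z, Commute z a ∧ Commute z b ∧ x = e * z := by
  have hma : a ∈ Subgroup.closure {a, b} := Subgroup.subset_closure (by simp)
  have hmb : b ∈ Subgroup.closure {a, b} := Subgroup.subset_closure (by simp)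
  -- The word `a ^ t * b ^ (-s)` has the same commutator exponents with `a` and `b` as `x`, so
  -- dividing it out leaves an element commuting with both.
  have hw := h.commBy_word t (-s) 0
  refine ⟨a ^ t * b ^ (-s) * c ^ (0 : ℤ), by
      simpa using mul_mem (zpow_mem hma t) (inv_mem (zpow_mem hmb s)),
    (a ^ t * b ^ (-s) * c ^ (0 : ℤ))⁻¹ * x, ?_, ?_, by group⟩
  · apply CommBy.commute (c := c)
    simpa using (hw.2.inv_left h.central).mul_left h.central hs
  · apply CommBy.commute (c := c)
    simpa using (hw.1.inv_left h.central).mul_left h.central ht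

/-- The commutators of the word with `b` and `a` recover `i` and `k` modulo `p`, and then `z` is
determined. This supplies the factor `p ^ 2` in the order counts. -/
theorem injective_word (h : IsHeisenbergPair p j a b c) (hp : p.Prime) (D : Subgroup G)
    (hD : ∀ z ∈ D, Commute z a ∧ Commute z b) :
    Function.Injective fun w : Fin p × Fin p × D => a ^ (w.1 : ℕ) * b ^ (w.2.1 : ℕ) * (w.2.2 : G) := by
  rintro ⟨i, k, z, hz⟩ ⟨i', k', z', hz'⟩ hww
  simp only at hww
  have key : ∀ (i k : ℕ) z, z ∈ D →
      CommBy c (a ^ i * b ^ k * z) b i ∧ CommBy c (a ^ i * b ^ k * z) a (-k) := by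
    intro i k z hz
    have hw := h.commBy_word i k 0
    simp only [zpow_natCast, zpow_zero, mul_one] at hw
    constructor
    · simpa using hw.1.mul_left h.central (CommBy.of_commute (hD z hz).2)
    · simpa using hw.2.mul_left h.central (CommBy.of_commute (hD z hz).1)
  have h1 := key i k z hz
  have h2 := key i' k' z' hz'
  rw [← hww] at h2
  have hfin : ∀ e e' : Fin p, c ^ ((e : ℕ) : ℤ) = c ^ ((e' : ℕ) : ℤ) → e = e' := by
    intro e e' he
    have := Fact.mk hp
    rw [zpow_natCast, zpow_natCast] at he
    apply Fin.ext
    refine pow_injOn_Iio_orderOf ?_ ?_ he <;>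
      simp [orderOf_eq_prime h.pow_eq_one h.ne_one]
  have hi := hfin _ _ (h1.1.zpow_eq h2.1)
  have hk : k = k' := by
    have := h1.2.zpow_eq h2.2
    rw [zpow_neg, zpow_neg, inv_inj] at this
    exact hfin _ _ this
  subst hi hk
  simpa using hww

end IsHeisenbergPair

end Calculus

/-! ### The presented groups `E p j`. -/

section Presented

variable {p j : ℕ}

/-- The generator `α` of `E d j`. -/
def genA (d j : ℕ) : E d j := PresentedGroup.of Gen.α

/-- The generator `β` of `E d j`. -/
def genB (d j : ℕ) : E d j := PresentedGroup.of Gen.β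

/-- The generator `γ` of `E d j`. -/
def genC (d j : ℕ) : E d j := PresentedGroup.of Gen.γ

theorem genA_pow (d j : ℕ) : genA d j ^ d = genC d j ^ j := by
  have := PresentedGroup.one_of_mem (rels := relators d j)
    (x := FreeGroup.of Gen.α ^ d * (FreeGroup.of Gen.γ ^ j)⁻¹) (by simp [relators])
  simpa [mul_inv_eq_one, genA, genB, genC, PresentedGroup.of] using this

theorem genB_pow (d j : ℕ) : genB d j ^ d = genC d j ^ j := by
  have := PresentedGroup.one_of_mem (rels := relators d j)
    (x := FreeGroup.of Gen.β ^ d * (FreeGroup.of Gen.γ ^ j)⁻¹) (by simp [relators])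
  simpa [mul_inv_eq_one, genA, genB, genC, PresentedGroup.of] using this

theorem genC_pow (d j : ℕ) : genC d j ^ d = 1 := by
  have := PresentedGroup.one_of_mem (rels := relators d j)
    (x := FreeGroup.of Gen.γ ^ d) (by simp [relators])
  simpa [genC, PresentedGroup.of] using this

theorem groupComm_eq_one_iff {G : Type*} [Group G] {g h : G} :
    groupComm g h = 1 ↔ Commute g h := by
  rw [groupComm, Commute, SemiconjBy]
  constructor
  · intro H
    calc g * h = h * g * (g⁻¹ * h⁻¹ * g * h) := by group
      _ = h * g := by rw [H, mul_one]
  · intro H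
    calc g⁻¹ * h⁻¹ * g * h = g⁻¹ * h⁻¹ * (g * h) := by group
      _ = 1 := by rw [H]; group

theorem commute_genA_genC (d j : ℕ) : Commute (genA d j) (genC d j) := by
  have := PresentedGroup.one_of_mem (rels := relators d j)
    (x := groupComm (FreeGroup.of Gen.α) (FreeGroup.of Gen.γ)) (by simp [relators])
  rw [← groupComm_eq_one_iff]
  simpa [groupComm, genA, genB, genC, PresentedGroup.of] using this

theorem commute_genB_genC (d j : ℕ) : Commute (genB d j) (genC d j) := by
  have := PresentedGroup.one_of_mem (rels := relators d j)
    (x := groupComm (FreeGroup.of Gen.β) (FreeGroup.of Gen.γ)) (by simp [relators])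
  rw [← groupComm_eq_one_iff]
  simpa [groupComm, genA, genB, genC, PresentedGroup.of] using this

theorem commBy_gen (d j : ℕ) : CommBy (genC d j) (genA d j) (genB d j) 1 := by
  have := PresentedGroup.one_of_mem (rels := relators d j)
    (x := groupComm (FreeGroup.of Gen.α) (FreeGroup.of Gen.β) * (FreeGroup.of Gen.γ)⁻¹)
    (by simp [relators])
  have h : groupComm (genA d j) (genB d j) = genC d j := by
    rw [← mul_inv_eq_one]
    simpa [groupComm, genA, genB, genC, PresentedGroup.of] using this
  rw [CommBy, ← h, groupComm]
  group

theorem closure_gen (d j : ℕ) : Subgroup.closure {genA d j, genB d j} = ⊤ := by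
  rw [eq_top_iff, ← PresentedGroup.closure_range_of, Subgroup.closure_le]
  have hma : genA d j ∈ Subgroup.closure {genA d j, genB d j} := Subgroup.subset_closure (by simp)
  have hmb : genB d j ∈ Subgroup.closure {genA d j, genB d j} := Subgroup.subset_closure (by simp)
  rintro _ ⟨g, rfl⟩
  cases g
  · exact hma
  · exact hmb
  · have h := commBy_gen d j
    rw [CommBy, zpow_one] at h
    have h' : genC d j = (genB d j * genA d j)⁻¹ * (genA d j * genB d j) := by
      rw [h, inv_mul_cancel_left]
    change genC d j ∈ Subgroup.closure {genA d j, genB d j}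
    rw [h']
    exact mul_mem (inv_mem (mul_mem hmb hma)) (mul_mem hma hmb)

theorem commute_genC (d j : ℕ) (g : E d j) : Commute (genC d j) g := by
  have hg : g ∈ Subgroup.closure {genA d j, genB d j} := by simp [closure_gen]
  have hle : Subgroup.closure {genA d j, genB d j} ≤ Subgroup.centralizer {genC d j} := by
    rw [Subgroup.closure_le]
    rintro _ (rfl | rfl)
    · exact Subgroup.mem_centralizer_singleton_iff.2 (commute_genA_genC d j).eq
    · exact Subgroup.mem_centralizer_singleton_iff.2 (commute_genB_genC d j).eq
  exact (Subgroup.mem_centralizer_singleton_iff.1 (hle hg)).symm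

theorem isHeisenbergPair_gen (h : genC p j ≠ 1) :
    IsHeisenbergPair p j (genA p j) (genB p j) (genC p j) :=
  ⟨commute_genC p j, genC_pow p j, h, commBy_gen p j, genA_pow p j, genB_pow p j⟩

theorem IsHeisenbergPair.exists_hom {G : Type*} [Group G] {a b c : G}
    (h : IsHeisenbergPair p j a b c) :
    ∃ f : E p j →* G, f (genA p j) = a ∧ f (genB p j) = b ∧ f (genC p j) = c := by
  let v : Gen → G := fun g => match g with
    | Gen.α => a
    | Gen.β => b
    | Gen.γ => c
  have hv : ∀ r ∈ relators p j, FreeGroup.lift v r = 1 := by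
    have h1 : groupComm a c = 1 := groupComm_eq_one_iff.2 (h.central a).symm
    have h2 : groupComm b c = 1 := groupComm_eq_one_iff.2 (h.central b).symm
    have h3 : groupComm a b = c := by
      have h4 := h.commBy
      rw [CommBy, zpow_one] at h4
      calc a⁻¹ * b⁻¹ * a * b = (b * a)⁻¹ * (a * b) := by group
        _ = c := by rw [h4, inv_mul_cancel_left]
    unfold groupComm at h1 h2 h3
    rintro r (rfl | rfl | rfl | rfl | rfl | rfl) <;>
      simp [groupComm, v, h.left_pow, h.right_pow, h.pow_eq_one, h1, h2, h3]
  exact ⟨PresentedGroup.toGroup hv, PresentedGroup.toGroup.of hv, PresentedGroup.toGroup.of hv,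
    PresentedGroup.toGroup.of hv⟩

/-- A presentation could collapse, so nontriviality of the generator `γ` is pulled back from a
concrete group. It is the only input needed below for the structure of `E p j`. -/
theorem genC_ne_one_of_hom {G : Type*} [Group G] {a b c : G}
    (h : IsHeisenbergPair p j a b c) : genC p j ≠ 1 := by
  obtain ⟨f, -, -, hf⟩ := h.exists_hom
  rintro h1
  rw [h1, map_one] at hf
  exact h.ne_one hf.symm

theorem mem_zpowers_genC_of_commute (hp : p.Prime) (h : genC p j ≠ 1) {x : E p j}
    (ha : Commute x (genA p j)) (hb : Commute x (genB p j)) : x ∈ Subgroup.zpowers (genC p j) :=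
  (isHeisenbergPair_gen h).mem_zpowers_of_commute hp (by simp [closure_gen]) ha hb

/-- Commutators of a kernel element with the generators are powers of `γ` in the kernel, hence
trivial. The element is therefore central, so itself a power of `γ`, hence trivial. -/
theorem injective_of_genC (hp : p.Prime) {G : Type*} [Group G] (f : E p j →* G)
    (h : f (genC p j) ≠ 1) : Function.Injective f := by
  have hC : genC p j ≠ 1 := fun h1 => h (by rw [h1, map_one])
  have hP := isHeisenbergPair_gen hC
  rw [injective_iff_map_eq_one]
  intro x hx
  have hcomm : ∀ y, ∀ i : ℤ, CommBy (genC p j) x y i → Commute x y := by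
    intro y i hi
    have h1 : f (genC p j ^ i) = 1 := by
      have h2 := congrArg f hi
      simp only [map_mul, hx, one_mul, mul_one] at h2
      exact (mul_eq_left.1 h2.symm)
    rw [map_zpow, zpow_eq_one_iff_dvd_of_prime hp (by rw [← map_pow, genC_pow, map_one]) h,
      ← zpow_eq_one_iff_dvd_of_prime hp hP.pow_eq_one hC] at h1
    rw [CommBy, h1, mul_one] at hi
    exact hi
  obtain ⟨i, k, l, hw⟩ := hP.commBy.exists_normal_form hP.central
    (x := x) (by simp [closure_gen])
  have hword := hP.commBy_word i k l
  rw [← hw] at hword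
  obtain ⟨e, rfl⟩ := mem_zpowers_genC_of_commute hp hC (hcomm _ _ hword.2) (hcomm _ _ hword.1)
  simp only [map_zpow] at hx ⊢
  rwa [zpow_eq_one_iff_dvd_of_prime hp (by rw [← map_pow, genC_pow, map_one]) h,
    ← zpow_eq_one_iff_dvd_of_prime hp hP.pow_eq_one hC] at hx

theorem center_E (hp : p.Prime) (h : genC p j ≠ 1) :
    Subgroup.center (E p j) = Subgroup.zpowers (genC p j) := by
  apply le_antisymm
  · intro x hx
    rw [Subgroup.mem_center_iff] at hx
    exact mem_zpowers_genC_of_commute hp h (hx _).symm (hx _).symm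
  · rw [Subgroup.zpowers_le, Subgroup.mem_center_iff]
    exact fun g => (commute_genC p j g).symm

theorem card_zpowers_genC (hp : p.Prime) (h : genC p j ≠ 1) :
    Nat.card (Subgroup.zpowers (genC p j)) = p := by
  have := Fact.mk hp
  rw [Nat.card_zpowers, orderOf_eq_prime (genC_pow p j) h]

theorem pow_pow_mem_zpowers_exists {G : Type*} [Group G] {a c : G} (hp : p.Prime)
    (ha : a ^ p = c ^ j) (i : ℤ) : ∃ (i' : Fin p) (l : ℤ), a ^ i = a ^ (i' : ℕ) * c ^ l := by
  have hp0 : (0 : ℤ) < p := by exact_mod_cast hp.pos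
  have hlt : (i % p).toNat < p := by
    have := Int.emod_lt_of_pos i hp0
    omega
  refine ⟨⟨(i % p).toNat, hlt⟩, j * (i / p), ?_⟩
  rw [← zpow_natCast a]
  rw [zpow_mul, zpow_natCast c, ← ha, ← zpow_natCast a, ← zpow_mul, ← zpow_add]
  congr 1
  simp only [Int.toNat_of_nonneg (Int.emod_nonneg i hp0.ne')]
  rw [Int.emod_add_mul_ediv]

theorem card_E (hp : p.Prime) (h : genC p j ≠ 1) : Nat.card (E p j) = p ^ 3 := by
  have hP := isHeisenbergPair_gen h
  have hinj := hP.injective_word hp (Subgroup.zpowers (genC p j)) (by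
    rintro _ ⟨l, rfl⟩
    exact ⟨(hP.central _).zpow_left l, (hP.central _).zpow_left l⟩)
  have hsurj : Function.Surjective fun w : Fin p × Fin p × Subgroup.zpowers (genC p j) =>
      genA p j ^ (w.1 : ℕ) * genB p j ^ (w.2.1 : ℕ) * (w.2.2 : E p j) := by
    intro x
    obtain ⟨i, k, l, rfl⟩ := hP.commBy.exists_normal_form hP.central (x := x)
      (by simp [closure_gen])
    obtain ⟨i', l', hi⟩ := pow_pow_mem_zpowers_exists hp hP.left_pow i
    obtain ⟨k', l'', hk⟩ := pow_pow_mem_zpowers_exists hp hP.right_pow k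
    refine ⟨(i', k', ⟨_, Subgroup.zpow_mem_zpowers (genC p j) (l' + l'' + l)⟩), ?_⟩
    rw [hi, hk]
    have h3 := ((hP.central (genB p j ^ (k' : ℕ))).zpow_left l').eq
    calc genA p j ^ (i' : ℕ) * genB p j ^ (k' : ℕ) * genC p j ^ (l' + l'' + l)
        = genA p j ^ (i' : ℕ) * (genB p j ^ (k' : ℕ) * genC p j ^ l') * genC p j ^ l'' *
            genC p j ^ l := by simp only [zpow_add, mul_assoc]
      _ = _ := by rw [← h3]; simp only [mul_assoc]
  rw [← Nat.card_congr (Equiv.ofBijective _ ⟨hinj, hsurj⟩)]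
  simp only [Nat.card_prod, card_zpowers_genC hp h, Nat.card_eq_fintype_card, Fintype.card_fin]
  ring

theorem finite_E (hp : p.Prime) (h : genC p j ≠ 1) : Finite (E p j) :=
  Nat.finite_of_card_ne_zero (by rw [card_E hp h]; exact (pow_pos hp.pos 3).ne')

theorem exists_commBy_gen (h : genC p j ≠ 1) (x : E p j) :
    (∃ i, CommBy (genC p j) x (genA p j) i) ∧ ∃ i, CommBy (genC p j) x (genB p j) i := by
  have hP := isHeisenbergPair_gen h
  obtain ⟨i, k, l, rfl⟩ := hP.commBy.exists_normal_form hP.central (x := x)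
    (by simp [closure_gen])
  exact ⟨⟨_, (hP.commBy_word i k l).2⟩, _, (hP.commBy_word i k l).1⟩

theorem commutator_E (h : genC p j ≠ 1) :
    commutator (E p j) = Subgroup.zpowers (genC p j) := by
  have hP := isHeisenbergPair_gen h
  apply le_antisymm
  · rw [commutator_def, Subgroup.commutator_le]
    intro x _ y _
    obtain ⟨i, k, l, hy⟩ := hP.commBy.exists_normal_form hP.central (x := y)
      (by simp [closure_gen])
    obtain ⟨⟨u, hu⟩, v, hv⟩ := exists_commBy_gen h x
    have hxy : ∃ t, CommBy (genC p j) x y t := by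
      rw [hy]
      exact ⟨_, ((hu.zpow_right hP.central i).mul_right hP.central
        (hv.zpow_right hP.central k)).mul_right hP.central
        (CommBy.of_commute (((hP.central x).zpow_left l).symm))⟩
    obtain ⟨t, ht⟩ := hxy
    rw [CommBy] at ht
    refine ⟨t, ?_⟩
    rw [commutatorElement_def]
    have h4 := ((hP.central (y * x)).zpow_left t).eq
    rw [ht, ← h4]
    group
  · rw [Subgroup.zpowers_le]
    have := hP.commBy
    rw [CommBy, zpow_one] at this
    -- Mathlib's bracket is `g * h * g⁻¹ * h⁻¹`, hence the inverses.
    open scoped commutatorElement in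
    have h5 : genC p j = ⁅(genA p j)⁻¹, (genB p j)⁻¹⁆ := by
      rw [commutatorElement_def, inv_inv, inv_inv, mul_assoc, this]; group
    rw [h5, commutator_def]
    exact Subgroup.commutator_mem_commutator (Subgroup.mem_top _) (Subgroup.mem_top _)

/-- If a maximal `M` misses the central `γ`, then `M` and `γ` generate everything. Both `α` and `β`
then agree with elements of `M` up to central factors, so `γ = [α, β]` is a commutator of elements
of `M`. -/
theorem genC_mem_of_isCoatom (d j : ℕ) {M : Subgroup (E d j)} (hM : IsCoatom M) :
    genC d j ∈ M := by
  by_contra hC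
  have htop : M ⊔ Subgroup.zpowers (genC d j) = ⊤ := hM.2 _ (by
    refine lt_of_le_of_ne le_sup_left fun h => hC ?_
    rw [h]
    exact (le_sup_right : Subgroup.zpowers (genC d j) ≤ _) (Subgroup.mem_zpowers _))
  have hcen : ∀ g, ∀ k : ℤ, Commute (genC d j ^ k) g := fun g k => (commute_genC d j g).zpow_left k
  have hdec : ∀ g, ∃ m ∈ M, ∃ k : ℤ, g = m * genC d j ^ k := by
    intro g
    have : (Subgroup.zpowers (genC d j)).Normal := ⟨by
      rintro _ ⟨k, rfl⟩ g
      exact ⟨k, by dsimp only; rw [← (hcen g k).eq, mul_inv_cancel_right]⟩⟩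
    have hg : g ∈ M ⊔ Subgroup.zpowers (genC d j) := by simp [htop]
    obtain ⟨m, hm, _, ⟨k, rfl⟩, rfl⟩ := Subgroup.mem_sup_of_normal_right.1 hg
    exact ⟨m, hm, k, rfl⟩
  obtain ⟨m, hm, k, ha⟩ := hdec (genA d j)
  obtain ⟨m', hm', k', hb⟩ := hdec (genB d j)
  have h := commBy_gen d j
  rw [CommBy, zpow_one, ha, hb] at h
  have h1 : m * genC d j ^ k * (m' * genC d j ^ k') = m * m' * (genC d j ^ k * genC d j ^ k') := by
    rw [mul_assoc m, ← mul_assoc (genC d j ^ k), (hcen m' k).eq]; simp only [mul_assoc]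
  have h2 : m' * genC d j ^ k' * (m * genC d j ^ k) * genC d j =
      m' * m * genC d j * (genC d j ^ k * genC d j ^ k') := by
    rw [mul_assoc m', ← mul_assoc (genC d j ^ k'), (hcen m k').eq]
    simp only [mul_assoc]
    congr 2
    group
  rw [h1, h2] at h
  have h3 : genC d j = (m' * m)⁻¹ * (m * m') := by
    rw [mul_right_cancel h]; group
  exact hC (h3 ▸ mul_mem (inv_mem (mul_mem hm' hm)) (mul_mem hm hm'))

/-- The centralizer is the kernel of the nontrivial map `x ↦ [x, g]` into the group `⟨c⟩` of order
`p`. -/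
theorem isCoatom_centralizer {G : Type*} [Group G] {c g : G} (hp : p.Prime)
    (hc : ∀ g, Commute c g) (hcp : c ^ p = 1) (hg : ∀ x, ∃ i, CommBy c x g i)
    (hne : ∃ x, ¬ Commute x g) : IsCoatom (Subgroup.centralizer {g}) := by
  have hpow : ∀ t : ℤ, c ^ ((p : ℤ) * t) = 1 := fun t => by
    rw [zpow_mul, zpow_natCast, hcp, one_zpow]
  constructor
  · rintro htop
    obtain ⟨x, hx⟩ := hne
    exact hx (Subgroup.mem_centralizer_singleton_iff.1 (by simp [htop]))
  · intro M hM
    obtain ⟨hle, y, hyM, hy⟩ := SetLike.lt_iff_le_and_exists.1 hM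
    rw [Subgroup.mem_centralizer_singleton_iff] at hy
    obtain ⟨s, hs⟩ := hg y
    have hsp : ¬ (p : ℤ) ∣ s := by
      rintro ⟨t, rfl⟩
      apply hy
      rw [CommBy, hpow, mul_one] at hs
      exact hs
    obtain ⟨u, v, huv⟩ := ((Nat.prime_iff_prime_int.1 hp).coprime_iff_not_dvd.2 hsp).symm
    rw [eq_top_iff]
    rintro x -
    obtain ⟨t, ht⟩ := hg x
    -- Since `u * s ≡ 1` modulo `p`, the element `y ^ (-(u * t)) * x` has commutator exponent
    -- divisible by `p` with `g`.
    have h1 := (hs.zpow_left hc (-(u * t))).mul_left hc ht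
    have h2 : -(u * t) * s + t = (p : ℤ) * (v * t) := by linear_combination -t * huv
    rw [h2, CommBy, hpow, mul_one] at h1
    have h3 : y ^ (-(u * t)) * x ∈ M := hle (Subgroup.mem_centralizer_singleton_iff.2 h1)
    exact (Subgroup.mul_mem_cancel_left M (zpow_mem hyM _)).1 h3

/-- The centralizers of `α` and `β` are maximal and meet in the centre `⟨γ⟩`, while every maximal
subgroup contains `γ`. -/
theorem frattini_E (hp : p.Prime) (h : genC p j ≠ 1) :
    frattini (E p j) = Subgroup.zpowers (genC p j) := by
  have hP := isHeisenbergPair_gen h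
  have hab : ¬ Commute (genA p j) (genB p j) := fun hcomm => by
    have := commBy_gen p j
    rw [CommBy, zpow_one, hcomm.eq] at this
    exact h (mul_eq_left.1 this.symm)
  apply le_antisymm
  · intro x hx
    have hA := frattini_le_coatom (isCoatom_centralizer hp hP.central hP.pow_eq_one
      (fun x => (exists_commBy_gen h x).1) ⟨_, fun h => hab h.symm⟩) hx
    have hB := frattini_le_coatom (isCoatom_centralizer hp hP.central hP.pow_eq_one
      (fun x => (exists_commBy_gen h x).2) ⟨_, hab⟩) hx
    rw [Subgroup.mem_centralizer_singleton_iff] at hA hB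
    exact mem_zpowers_genC_of_commute hp h hA hB
  · rw [Subgroup.zpowers_le, frattini, Order.radical]
    simp only [Subgroup.mem_iInf]
    exact fun M hM => genC_mem_of_isCoatom p j hM

theorem isExtraSpecial_E (hp : p.Prime) (h : genC p j ≠ 1) : IsExtraSpecial p (E p j) := by
  have := Fact.mk hp
  have := finite_E hp h
  refine ⟨⟨‹_›, IsPGroup.of_card (card_E hp h), Or.inr ⟨?_, ?_, ?_⟩⟩, ?_, ?_⟩
  · rw [frattini_E hp h, center_E hp h]
  · rw [commutator_E h, center_E hp h]
  · rw [frattini_E hp h]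
    constructor
    · exact fun x y => mul_comm' x y
    · rintro ⟨_, k, rfl⟩
      ext
      change (genC p j ^ k) ^ p = 1
      rw [← zpow_natCast, zpow_comm, zpow_natCast, genC_pow, one_zpow]
  · intro hcomm
    have := commBy_gen p j
    rw [CommBy, zpow_one, hcomm (genA p j)] at this
    exact h (mul_eq_left.1 this.symm)
  · rw [center_E hp h]
    infer_instance

end Presented

/-! ### From internal to external central products. -/

section Gluing

theorem CentralIso.ext_of_source_eq {G₁ G₂ : Type*} [Group G₁] [Group G₂]
    {ψ φ : CentralIso G₁ G₂} (h : ψ.Extends φ) (hs : ψ.source ≤ φ.source) : ψ = φ := by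
  obtain ⟨hle, h⟩ := h
  obtain ⟨s, t, hs1, ht1, e⟩ := ψ
  obtain ⟨s', t', hs1', ht1', e'⟩ := φ
  obtain rfl : s = s' := le_antisymm hs hle
  have h' : ∀ z : s, (e z : G₂) = e' z := h
  obtain rfl : t = t' := by
    apply le_antisymm
    · intro x hx
      have := h' (e.symm ⟨x, hx⟩)
      rw [MulEquiv.apply_symm_apply] at this
      change x = _ at this
      rw [this]
      exact SetLike.coe_mem _
    · intro x hx
      have := h' (e'.symm ⟨x, hx⟩)
      rw [MulEquiv.apply_symm_apply] at this
      change _ = x at this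
      rw [← this]
      exact SetLike.coe_mem _
  congr
  ext z
  exact h' z

variable {G₀ G₁ T : Type*} [Group G₀] [Group G₁] [Group T]

/-- The restriction of an injective homomorphism to the preimage of a subgroup of its range. -/
noncomputable def comapEquiv (f : G₀ →* T) (hf : Function.Injective f) (C : Subgroup T)
    (hC : C ≤ f.range) : C.comap f ≃* C :=
  MulEquiv.ofBijective (f.subgroupComap C) (by
    constructor
    · intro x y hxy
      exact Subtype.ext (hf (congrArg Subtype.val hxy))
    · rintro ⟨y, hy⟩
      obtain ⟨x, rfl⟩ := hC hy
      exact ⟨⟨x, hy⟩, rfl⟩)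

theorem comap_le_center (f : G₀ →* T) (hf : Function.Injective f) {C : Subgroup T}
    (hC : C ≤ Subgroup.center T) : C.comap f ≤ Subgroup.center G₀ := by
  intro x hx
  rw [Subgroup.mem_center_iff]
  intro g
  apply hf
  rw [map_mul, map_mul]
  exact Subgroup.mem_center_iff.1 (hC hx) _

/-- An internal central product of two subgroups over the centre `C` of the first one is an external
central product for a maximal central isomorphism. -/
theorem exists_centralIso (f₀ : G₀ →* T) (f₁ : G₁ →* T) (h₀ : Function.Injective f₀)
    (h₁ : Function.Injective f₁) (C : Subgroup T) (hC : C ≤ Subgroup.center T)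
    (hC₀ : C ≤ f₀.range) (hC₁ : C ≤ f₁.range) (hcomm : ∀ x y, Commute (f₀ x) (f₁ y))
    (hcen : ∀ x, (∀ y, Commute (f₀ x) (f₀ y)) → f₀ x ∈ C) :
    ∃ φ : CentralIso G₀ G₁, φ.IsMaximal ∧ Nonempty (φ.source ≃* C) ∧
      ∃ F : φ.CentralProduct →* T, Function.Injective F ∧
        ∀ t, t ∈ F.range ↔ ∃ x y, t = f₀ x * f₁ y := by
  let φ : CentralIso G₀ G₁ :=
    { source := C.comap f₀
      target := C.comap f₁
      source_le := comap_le_center f₀ h₀ hC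
      target_le := comap_le_center f₁ h₁ hC
      equiv := (comapEquiv f₀ h₀ C hC₀).trans (comapEquiv f₁ h₁ C hC₁).symm }
  have hφ : ∀ z : φ.source, f₁ (φ.equiv z) = f₀ z := by
    intro z
    have : comapEquiv f₁ h₁ C hC₁ (φ.equiv z) = comapEquiv f₀ h₀ C hC₀ z :=
      MulEquiv.apply_symm_apply (comapEquiv f₁ h₁ C hC₁) _
    exact congrArg Subtype.val this
  have hker : φ.kernel = (MonoidHom.noncommCoprod f₀ f₁ hcomm).ker := by
    ext ⟨x, y⟩
    rw [MonoidHom.mem_ker, MonoidHom.noncommCoprod_apply]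
    constructor
    · rintro ⟨z, hz⟩
      obtain ⟨rfl, rfl⟩ := Prod.mk.inj hz
      simp [hφ]
    · intro h
      have hy : f₀ x = f₁ y⁻¹ := by rw [map_inv]; exact eq_inv_of_mul_eq_one_left h
      -- An element of both images commutes with the whole image of `f₀`, so it lies in `C`.
      have hx : f₀ x ∈ C := hcen x fun w => by
        rw [hy]; exact (hcomm w y⁻¹).symm
      refine ⟨⟨x, hx⟩, Prod.ext rfl (h₁ ?_)⟩
      simp only [map_inv, hφ]
      rw [hy, map_inv, inv_inv]
  refine ⟨φ, ?_, ⟨comapEquiv f₀ h₀ C hC₀⟩,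
    QuotientGroup.lift φ.kernel (MonoidHom.noncommCoprod f₀ f₁ hcomm) hker.le, ?_, ?_⟩
  · intro ψ hψ
    apply CentralIso.ext_of_source_eq hψ
    -- Maximality: by `hcen` the source of `φ` already contains the whole centre of `G₀`.
    intro x hx
    apply hcen x
    intro y
    rw [Commute, SemiconjBy, ← map_mul, ← map_mul, Subgroup.mem_center_iff.1 (ψ.source_le hx) y]
  · rw [← MonoidHom.ker_eq_bot_iff, QuotientGroup.ker_lift, ← hker]
    exact (Subgroup.map_eq_bot_iff _).2 (by simp)
  · intro t
    constructor
    · rintro ⟨q, rfl⟩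
      obtain ⟨⟨x, y⟩, rfl⟩ := QuotientGroup.mk_surjective q
      exact ⟨x, y, rfl⟩
    · rintro ⟨x, y, rfl⟩
      exact ⟨QuotientGroup.mk (x, y), rfl⟩

end Gluing

/-! ### The abelian factor: ranks and structure. -/

section Abelian

theorem rank_le_of_closure_range {A : Type*} [Group A] [Group.FG A] {m : ℕ} (g : Fin m → A)
    (h : Subgroup.closure (Set.range g) = ⊤) : Group.rank A ≤ m := by
  classical
  refine (Group.rank_le (S := Finset.univ.image g) (by simpa using h)).trans ?_
  simpa using Finset.card_image_le (s := Finset.univ) (f := g)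

theorem rank_le_of_forall_sum {B : Type*} [AddCommGroup B] [Group.FG (Multiplicative B)] {m : ℕ}
    (b : Fin m → B) (h : ∀ x, ∃ v : Fin m → ℤ, x = ∑ i, v i • b i) :
    Group.rank (Multiplicative B) ≤ m := by
  apply rank_le_of_closure_range fun i => Multiplicative.ofAdd (b i)
  rw [eq_top_iff]
  rintro x -
  obtain ⟨v, hv⟩ := h x.toAdd
  have hx : x = ∏ i, Multiplicative.ofAdd (b i) ^ v i := by
    rw [← ofAdd_toAdd x, hv, ofAdd_sum]
    rfl
  rw [hx]
  refine Subgroup.prod_mem _ fun i _ => zpow_mem (Subgroup.subset_closure ?_) _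
  exact ⟨i, rfl⟩

theorem pi_zmod_eq_sum {p m : ℕ} (x : Fin m → ZMod p) :
    ∃ v : Fin m → ℤ, x = ∑ i, v i • Pi.single i (1 : ZMod p) := by
  choose v hv using fun i => ZMod.intCast_surjective (x i)
  refine ⟨v, ?_⟩
  ext i
  simp [Finset.sum_apply, Pi.single_apply, hv]

/-- The order of a finite abelian group divides its exponent to the power of its rank. -/
theorem le_rank_of_card {p m : ℕ} (hp : p.Prime) {A : Type*} [CommGroup A] [Finite A]
    (h : ∀ x : A, x ^ p = 1) (hc : Nat.card A = p ^ m) : m ≤ Group.rank A := by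
  have h1 := card_dvd_exponent_pow_rank A
  rw [hc] at h1
  exact (Nat.pow_dvd_pow_iff_le_right hp.one_lt).1
    (h1.trans (pow_dvd_pow_of_dvd (Monoid.exponent_dvd_of_forall_pow_eq_one h) _))

theorem rank_pi_zmod {p : ℕ} (hp : p.Prime) (m : ℕ) :
    have := Fact.mk hp
    Group.rank (Multiplicative (Fin m → ZMod p)) = m := by
  have := Fact.mk hp
  apply le_antisymm
  · exact rank_le_of_forall_sum (fun i => Pi.single i (1 : ZMod p)) pi_zmod_eq_sum
  · apply le_rank_of_card hp
    · intro x
      apply Multiplicative.toAdd.injective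
      ext i
      simp
    · simp

theorem rank_pi_zmod_prod {p : ℕ} (hp : p.Prime) (k : ℕ) :
    have := Fact.mk hp
    Group.rank (Multiplicative ((Fin k → ZMod p) × ZMod (p ^ 2))) = k + 1 := by
  have := Fact.mk hp
  apply le_antisymm
  · refine rank_le_of_forall_sum (Fin.cons (0, 1) fun i => (Pi.single i (1 : ZMod p), 0)) ?_
    rintro ⟨x, y⟩
    obtain ⟨v, hv⟩ := pi_zmod_eq_sum x
    obtain ⟨n, hn⟩ := ZMod.intCast_surjective y
    refine ⟨Fin.cons n v, ?_⟩
    rw [Fin.sum_univ_succ]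
    simp only [Fin.cons_zero, Fin.cons_succ]
    ext1
    · simpa [Prod.fst_sum] using hv
    · simp [Prod.snd_sum, hn]
  -- Reducing the last coordinate modulo `p` gives an elementary abelian quotient of order `p ^ (k +
  -- 1)`, which bounds the rank from below.
  · let f : (Fin k → ZMod p) × ZMod (p ^ 2) →+ (Fin k → ZMod p) × ZMod p :=
      (AddMonoidHom.id _).prodMap (ZMod.castHom (dvd_pow_self p two_ne_zero : p ∣ p ^ 2) (ZMod p)).toAddMonoidHom
    have hf : Function.Surjective f :=
      Function.surjective_id.prodMap (ZMod.castHom_surjective (dvd_pow_self p two_ne_zero))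
    have h1 : k + 1 ≤ Group.rank (Multiplicative ((Fin k → ZMod p) × ZMod p)) := by
      apply le_rank_of_card hp
      · intro x
        apply Multiplicative.toAdd.injective
        ext i <;> simp
      · simp [pow_succ]
    exact h1.trans (Group.rank_le_of_surjective (AddMonoidHom.toMultiplicative f) hf)

theorem exists_addEquiv_pi {p : ℕ} (hp : p.Prime) {B : Type*} [AddCommGroup B] [Finite B]
    (h : ∀ x : B, p • x = 0) : ∃ m, Nonempty (B ≃+ (Fin m → ZMod p)) := by
  have := Fact.mk hp
  let _ : Module (ZMod p) B := AddCommGroup.zmodModule (n := p) h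
  let b := Module.finBasis (ZMod p) B
  exact ⟨_, ⟨b.equivFun.toAddEquiv⟩⟩

theorem zsmul_eq_zero_iff_of_prime {p : ℕ} (hp : p.Prime) {B : Type*} [AddCommGroup B] {c : B}
    (hc : p • c = 0) (h0 : c ≠ 0) (n : ℤ) : n • c = 0 ↔ (p : ℤ) ∣ n := by
  have := Fact.mk hp
  rw [← addOrderOf_eq_prime hc h0, addOrderOf_dvd_iff_zsmul_eq_zero]

/-- In the `p`-torsion `V`, choose a complement `W` of the line spanned by `p • y`. Then `B` is the
direct sum of `W` and the cyclic group of order `p ^ 2` generated by `y`, because some `x - n • y`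
is `p`-torsion for each `x`. -/
theorem exists_addEquiv_prod {p : ℕ} (hp : p.Prime) {B : Type*} [AddCommGroup B] [Finite B]
    {y : B} (hy : p • y ≠ 0) (hpy : p • p • y = 0)
    (h : ∀ x : B, ∃ n : ℤ, p • x = n • p • y) :
    ∃ k, Nonempty ((Fin k → ZMod p) × ZMod (p ^ 2) ≃+ B) := by
  have := Fact.mk hp
  let V : AddSubgroup B := (nsmulAddMonoidHom p : B →+ B).ker
  have hV : ∀ x : B, x ∈ V ↔ p • x = 0 := fun x => Iff.rfl
  let _ : Module (ZMod p) V := AddCommGroup.zmodModule (n := p) fun x => Subtype.ext ((hV x).1 x.2)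
  let c : V := ⟨p • y, hpy⟩
  obtain ⟨W, hW⟩ : ∃ W : Submodule (ZMod p) V, IsCompl (Submodule.span (ZMod p) {c}) W :=
    Submodule.exists_isCompl _
  let b := Module.finBasis (ZMod p) W
  refine ⟨Module.finrank (ZMod p) W, ?_⟩
  have hspan : ∀ n : ℤ, n • c ∈ Submodule.span (ZMod p) {c} := fun n => by
    rw [← Int.cast_smul_eq_zsmul (ZMod p)]
    exact Submodule.smul_mem _ _ (Submodule.mem_span_singleton_self c)
  let g : ZMod (p ^ 2) →+ B := ZMod.lift (p ^ 2) ⟨zmultiplesHom B y, by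
    simp [pow_two, mul_smul, hpy]⟩
  have hg : ∀ n : ℤ, g n = n • y := fun n => by simp [g]
  let F : W × ZMod (p ^ 2) →+ B := (V.subtype.comp W.toAddSubgroup.subtype).coprod g
  have hF : ∀ w n, F (w, n) = ((w : V) : B) + g n := fun w n => rfl
  have hbij : Function.Bijective F := by
    constructor
    · rw [injective_iff_map_eq_zero]
      rintro ⟨w, n⟩ hwn
      obtain ⟨n, rfl⟩ := ZMod.intCast_surjective n
      rw [hF, hg] at hwn
      have h1 : n • p • y = 0 := by
        have := congrArg (p • ·) hwn
        simp only [smul_add, (hV _).1 (w : V).2, zero_add, smul_zero] at this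
        rw [smul_comm, this]
      obtain ⟨n, rfl⟩ := (zsmul_eq_zero_iff_of_prime hp hpy hy n).1 h1
      have h2 : (w : V) + n • c = 0 := by
        ext
        simp only [AddSubgroup.coe_add, AddSubgroup.coe_zsmul, AddSubgroup.coe_zero, c]
        rw [← hwn, mul_comm, mul_smul, natCast_zsmul]
      have h3 : (w : V) ∈ Submodule.span (ZMod p) {c} := by
        rw [eq_neg_of_add_eq_zero_left h2, ← neg_smul]; exact hspan _
      have h4 : (w : V) = 0 := (Submodule.disjoint_def.1 hW.disjoint) _ h3 w.2
      rw [h4, zero_add] at h2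
      have h5 : n • p • y = 0 := congrArg Subtype.val h2
      obtain ⟨n, rfl⟩ := (zsmul_eq_zero_iff_of_prime hp hpy hy n).1 h5
      have h6 : (((p : ℤ) * ((p : ℤ) * n) : ℤ) : ZMod (p ^ 2)) = 0 := by
        rw [ZMod.intCast_zmod_eq_zero_iff_dvd]
        exact ⟨n, by push_cast; ring⟩
      exact Prod.ext (Subtype.ext h4) h6
    · intro x
      obtain ⟨n, hn⟩ := h x
      have hx : x - n • y ∈ V := by
        rw [hV, smul_sub, hn, smul_comm, sub_self]
      have hmem : (⟨x - n • y, hx⟩ : V) ∈ Submodule.span (ZMod p) {c} ⊔ W := by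
        rw [hW.codisjoint.eq_top]; trivial
      obtain ⟨u, hu, w, hw, huw⟩ := Submodule.mem_sup.1 hmem
      obtain ⟨a, rfl⟩ := Submodule.mem_span_singleton.1 hu
      obtain ⟨k, rfl⟩ := ZMod.intCast_surjective a
      rw [Int.cast_smul_eq_zsmul] at huw
      have h7 : k • p • y + (w : B) = x - n • y := congrArg Subtype.val huw
      refine ⟨(⟨w, hw⟩, ((k * p + n : ℤ) : ZMod (p ^ 2))), ?_⟩
      rw [hF, hg, add_smul, mul_smul, natCast_zsmul, ← add_assoc, add_comm (w : B), h7,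
        sub_add_cancel]
  exact ⟨(b.equivFun.symm.toAddEquiv.prodCongr
    (AddEquiv.refl _)).trans (AddEquiv.ofBijective F hbij)⟩

theorem exists_memA {p : ℕ} (hp : p.Prime) {D : Type*} [CommGroup D] [Finite D] {c : D}
    (hc : c ^ p = 1) (h1 : c ≠ 1) (h : ∀ x : D, x ^ p ∈ Subgroup.zpowers c) :
    ∃ m, 0 < m ∧ p ^ m ≤ Nat.card D ∧ ∃ (A : Type) (_ : CommGroup A), MemA m p A ∧
      (Nonempty (A ≃* Multiplicative (Fin m → ZMod p)) ∨
        Nonempty (A ≃* Multiplicative ((Fin (m - 1) → ZMod p) × ZMod (p ^ 2)))) ∧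
      Nonempty (A ≃* D) := by
  have := Fact.mk hp
  by_cases hD : ∀ x : D, x ^ p = 1
  · obtain ⟨m, ⟨e⟩⟩ := exists_addEquiv_pi (B := Additive D) hp hD
    let e' : Multiplicative (Fin m → ZMod p) ≃* D := (AddEquiv.toMultiplicative e).symm
    have hcard : Nat.card D = p ^ m := by
      rw [← Nat.card_congr e'.toEquiv]; simp
    refine ⟨m, ?_, hcard.ge, _, inferInstance, ⟨inferInstance, rank_pi_zmod hp m,
      e'.symm c, ?_⟩, Or.inl ⟨MulEquiv.refl _⟩, ⟨e'⟩⟩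
    · by_contra hm
      obtain rfl : m = 0 := by omega
      rw [pow_zero, Nat.card_eq_one_iff_unique] at hcard
      exact h1 (hcard.1.elim _ _)
    · rw [MulEquiv.orderOf_eq, orderOf_eq_prime hc h1]
  · push Not at hD
    obtain ⟨y, hy⟩ := hD
    obtain ⟨n, hn⟩ := h y
    -- As `⟨c⟩` has prime order, `y ^ p` generates it, so every `p`-th power is a power of `y ^ p`.
    have hcy : c ∈ Subgroup.zpowers (y ^ p) :=
      mem_zpowers_of_ne_one hp hc (h y) hy
    obtain ⟨k, ⟨e⟩⟩ := exists_addEquiv_prod (B := Additive D) hp (y := Additive.ofMul y) hy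
      (by
        change (y ^ p) ^ p = 1
        rw [← hn]
        change (c ^ n) ^ p = 1
        rw [← zpow_natCast, zpow_comm, zpow_natCast, hc, one_zpow])
      (fun x => by
        obtain ⟨l, hl⟩ := (Subgroup.zpowers_le.2 hcy) (h x.toMul)
        exact ⟨l, hl.symm⟩)
    let e' : Multiplicative ((Fin k → ZMod p) × ZMod (p ^ 2)) ≃* D := AddEquiv.toMultiplicative e
    have hcard : Nat.card D = p ^ (k + 2) := by
      rw [← Nat.card_congr e'.toEquiv]; simp [pow_add]
    refine ⟨k + 1, k.succ_pos, ?_, _, inferInstance, ⟨inferInstance, rank_pi_zmod_prod hp k,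
      e'.symm c, ?_⟩, Or.inr ⟨MulEquiv.refl _⟩, ⟨e'⟩⟩
    -- Here `m = k + 1` but the order is `p ^ (k + 2)`, so the bound is strict.
    · rw [hcard]; exact Nat.pow_le_pow_right hp.pos (by omega)
    · rw [MulEquiv.orderOf_eq, orderOf_eq_prime hc h1]

end Abelian

/-! ### Splitting off copies of `E p j`. -/

section Decomposition

theorem CommBy.of_mem_zpowers {T : Type*} [Group T] {c c' x y : T} {i : ℤ} (h : CommBy c x y i)
    (hc : c ∈ Subgroup.zpowers c') : ∃ k, CommBy c' x y k := by
  obtain ⟨l, rfl⟩ := hc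
  exact ⟨l * i, by rw [CommBy, zpow_mul]; exact h⟩

/-- The element `c` is central of order `p`, and all commutators and `p`-th powers are powers
of `c`. -/
structure IsCommutatorGenerator (p : ℕ) {T : Type*} [Group T] (c : T) : Prop where
  central : ∀ g, Commute c g
  pow_eq_one : c ^ p = 1
  ne_one : c ≠ 1
  commBy : ∀ x y, ∃ i, CommBy c x y i
  pow_mem : ∀ x, x ^ p ∈ Subgroup.zpowers c

theorem range_eq_closure {p j : ℕ} {T : Type*} [Group T] (f : E p j →* T) :
    f.range = Subgroup.closure {f (genA p j), f (genB p j)} := by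
  rw [MonoidHom.range_eq_map, ← closure_gen, MonoidHom.map_closure, Set.image_pair]

theorem factorList_cons (d j₀ : ℕ) {n : ℕ} (j : Fin n → ℕ) (A : Type) [CommGroup A] :
    factorList d (Fin.cons j₀ j : Fin (n + 1) → ℕ) A = GrpCat.of (E d j₀) :: factorList d j A := by
  rw [factorList, List.ofFn_succ]
  rfl

variable {p : ℕ} {T : Type*} [Group T] {c : T}

/-- The splitting step inside a subgroup `D`: a non-commuting pair yields a copy of `E p j` in `D`,
and `exists_commute` writes `D` as this copy times its centralizer in `D`, whose order is smaller by
a factor of at least `p ^ 2`. -/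
theorem IsCommutatorGenerator.exists_hom_E (h : IsCommutatorGenerator p c) (hp : p.Prime) [Finite T]
    (D : Subgroup T) (hD : ∃ x ∈ D, ∃ y ∈ D, ¬ Commute x y) :
    ∃ j, (j = 0 ∨ j = 1) ∧ genC p j ≠ 1 ∧ ∃ f : E p j →* T, Function.Injective f ∧
      Subgroup.zpowers c ≤ f.range ∧ f.range ≤ D ∧
      (∀ x, (∀ y, Commute (f x) (f y)) → f x ∈ Subgroup.zpowers c) ∧
      (∀ x ∈ D, ∃ e, ∃ z ∈ D ⊓ Subgroup.centralizer f.range, x = f e * z) ∧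
      p ^ 2 * Nat.card (D ⊓ Subgroup.centralizer (f.range : Set T) : Subgroup T) ≤ Nat.card D := by
  obtain ⟨x, hx, y, hy, hxy⟩ := hD
  obtain ⟨i, hi⟩ := h.commBy x y
  have hci : c ^ i ≠ 1 := fun h1 => hxy (by rw [CommBy, h1, mul_one] at hi; exact hi)
  have hmem := mem_zpowers_of_ne_one hp h.pow_eq_one (Subgroup.zpow_mem_zpowers c i) hci
  have hpow : ∀ x, ∃ u : ℤ, x ^ p = (c ^ i) ^ u := fun x => by
    obtain ⟨u, hu⟩ := (Subgroup.zpowers_le.2 hmem) (h.pow_mem x)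
    exact ⟨u, hu.symm⟩
  obtain ⟨u, hu⟩ := hpow x
  obtain ⟨v, hv⟩ := hpow y
  obtain ⟨a, ha, b, hb, c', hc', j, hj, hP⟩ := exists_isHeisenbergPair hp (c := c ^ i)
    (fun g => (h.central g).zpow_left i)
    (by rw [← zpow_natCast, zpow_comm, zpow_natCast, h.pow_eq_one, one_zpow]) hci
    (by rw [CommBy, zpow_one]; exact hi) hu hv
  have hc'c : c' ∈ Subgroup.zpowers c :=
    (Subgroup.zpowers_le.2 (Subgroup.zpow_mem_zpowers c i)) hc'
  have hcc' : c ∈ Subgroup.zpowers c' :=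
    mem_zpowers_of_ne_one hp h.pow_eq_one hc'c hP.ne_one
  have hle : Subgroup.closure {x, y} ≤ D := by
    rw [Subgroup.closure_le]
    rintro _ (rfl | rfl) <;> assumption
  obtain ⟨f, hfa, hfb, hfc⟩ := hP.exists_hom
  have hrange : f.range = Subgroup.closure {a, b} := by rw [range_eq_closure, hfa, hfb]
  have hcent : ∀ z, Commute z a → Commute z b → z ∈ Subgroup.centralizer (f.range : Set T) := by
    intro z hza hzb
    have hzr : f.range ≤ Subgroup.centralizer {z} := by
      rw [hrange, Subgroup.closure_le]
      rintro w (rfl | rfl)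
      · exact Subgroup.mem_centralizer_singleton_iff.2 hza.symm
      · exact Subgroup.mem_centralizer_singleton_iff.2 hzb.symm
    exact Subgroup.mem_centralizer_iff.2 fun w hw =>
      Subgroup.mem_centralizer_singleton_iff.1 (hzr hw)
  have hcent' : ∀ z ∈ D ⊓ Subgroup.centralizer (f.range : Set T), Commute z a ∧ Commute z b := by
    intro z hz
    have := Subgroup.mem_centralizer_iff.1 hz.2
    exact ⟨(this a ⟨_, hfa⟩).symm, (this b ⟨_, hfb⟩).symm⟩
  have hrD : f.range ≤ D := by
    rw [hrange, Subgroup.closure_le]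
    rintro _ (rfl | rfl)
    exacts [hle ha, hle hb]
  refine ⟨j, hj, genC_ne_one_of_hom hP, f, injective_of_genC hp f (hfc ▸ hP.ne_one), ?_, hrD,
    ?_, ?_, ?_⟩
  · rw [Subgroup.zpowers_le]
    obtain ⟨l, rfl⟩ := hcc'
    exact ⟨genC p j ^ l, by rw [map_zpow, hfc]⟩
  · intro x hx
    apply (Subgroup.zpowers_le.2 hc'c)
    exact hP.mem_zpowers_of_commute hp (hrange ▸ ⟨x, rfl⟩) (hfa ▸ hx _) (hfb ▸ hx _)
  · intro x hx
    obtain ⟨s, hs⟩ := h.commBy x a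
    obtain ⟨t, ht⟩ := h.commBy x b
    obtain ⟨s, hs⟩ := hs.of_mem_zpowers hcc'
    obtain ⟨t, ht⟩ := ht.of_mem_zpowers hcc'
    obtain ⟨e, he, z, hza, hzb, rfl⟩ := hP.exists_commute hs ht
    rw [← hrange] at he
    have hzD : z ∈ D := (Subgroup.mul_mem_cancel_left D (hrD he)).1 hx
    obtain ⟨e, rfl⟩ := he
    exact ⟨e, z, ⟨hzD, hcent z hza hzb⟩, rfl⟩
  · set D' := D ⊓ Subgroup.centralizer (f.range : Set T)
    have hinj := hP.injective_word hp D' hcent'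
    let g : Fin p × Fin p × D' → D := fun w =>
      ⟨a ^ (w.1 : ℕ) * b ^ (w.2.1 : ℕ) * w.2.2,
        mul_mem (mul_mem (D.pow_mem (hle ha) _) (D.pow_mem (hle hb) _)) w.2.2.2.1⟩
    have hg : Function.Injective g := fun w w' hw => hinj (congrArg Subtype.val hw)
    have := Nat.card_le_card_of_injective g hg
    simpa [Nat.card_prod, pow_two, mul_assoc] using this

/-- Induction on the order `N` of the centralizer of the part already built. The invariants are that
this part contains `⟨c⟩`, that its centre lies in `⟨c⟩`, and that together with its centralizer it
fills `T`. -/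
theorem IsCommutatorGenerator.exists_iterated (h : IsCommutatorGenerator p c) (hp : p.Prime)
    [Finite T] (N : ℕ) : ∀ (G₀ : GrpCat.{0}) (f₀ : G₀ →* T), Function.Injective f₀ →
      Subgroup.zpowers c ≤ f₀.range →
      (∀ x, (∀ y, Commute (f₀ x) (f₀ y)) → f₀ x ∈ Subgroup.zpowers c) →
      (∀ t, ∃ x, ∃ z ∈ Subgroup.centralizer (f₀.range : Set T), t = f₀ x * z) →
      Nat.card (Subgroup.centralizer (f₀.range : Set T)) = N →
      ∃ n m, 0 < m ∧ p ^ (2 * n + m) ≤ N ∧ ∃ j : Fin n → ℕ,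
        (∀ k, (j k = 0 ∨ j k = 1) ∧ genC p (j k) ≠ 1) ∧
        ∃ (A : Type) (_ : CommGroup A), MemA m p A ∧
          (Nonempty (A ≃* Multiplicative (Fin m → ZMod p)) ∨
            Nonempty (A ≃* Multiplicative ((Fin (m - 1) → ZMod p) × ZMod (p ^ 2)))) ∧
          IsIteratedCentralProductFrom p T G₀ (factorList p j A) := by
  have := Fact.mk hp
  have hcen : Subgroup.zpowers c ≤ Subgroup.center T := by
    rw [Subgroup.zpowers_le, Subgroup.mem_center_iff]
    exact fun g => (h.central g).symm
  have hcard : Nat.card (Subgroup.zpowers c) = p := by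
    rw [Nat.card_zpowers, orderOf_eq_prime h.pow_eq_one h.ne_one]
  induction N using Nat.strong_induction_on with
  | _ N ih =>
  intro G₀ f₀ hinj hcf hcenter hdec hN
  set D := Subgroup.centralizer (f₀.range : Set T) with hDdef
  have hcD : c ∈ D := Subgroup.center_le_centralizer _ (hcen (Subgroup.mem_zpowers c))
  have hcommD : ∀ x, ∀ z ∈ D, Commute (f₀ x) z := fun x z hz =>
    Subgroup.mem_centralizer_iff.1 hz _ ⟨x, rfl⟩
  have hfin : ∀ {G : Type} [Group G] (φ : CentralIso G₀ G),
      Nonempty (φ.source ≃* Subgroup.zpowers c) →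
      IsCyclic φ.source ∧ Nat.card φ.source = p := by
    rintro G _ φ ⟨e⟩
    exact ⟨isCyclic_of_surjective e.symm e.symm.surjective, by
      rw [Nat.card_congr e.toEquiv, hcard]⟩
  by_cases hD : ∃ x ∈ D, ∃ y ∈ D, ¬ Commute x y
  · obtain ⟨j₀, hj₀, hγ, f, hf, hcf', hfD, hfcen, hfdec, hfcard⟩ := h.exists_hom_E hp D hD
    obtain ⟨φ, hmax, hφ, F, hF, hFr⟩ := exists_centralIso f₀ f hinj hf (Subgroup.zpowers c) hcen hcf
      hcf' (fun x y => hcommD x _ (hfD ⟨y, rfl⟩)) hcenter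
    have hFcent : Subgroup.centralizer (F.range : Set T) =
        D ⊓ Subgroup.centralizer (f.range : Set T) := by
      ext z
      simp only [Subgroup.mem_inf, hDdef, Subgroup.mem_centralizer_iff]
      constructor
      · intro hz
        refine ⟨fun w hw => hz w ?_, fun w hw => hz w ?_⟩
        · obtain ⟨x, rfl⟩ := hw
          exact (hFr _).2 ⟨x, 1, by simp⟩
        · obtain ⟨x, rfl⟩ := hw
          exact (hFr _).2 ⟨1, x, by simp⟩
      · rintro ⟨hz1, hz2⟩ w hw
        obtain ⟨x, y, rfl⟩ := (hFr w).1 hw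
        exact Commute.mul_left (hz1 _ ⟨x, rfl⟩) (hz2 _ ⟨y, rfl⟩)
    have hlt : Nat.card (Subgroup.centralizer (F.range : Set T)) < N := by
      have hpos : 0 < Nat.card (D ⊓ Subgroup.centralizer (f.range : Set T) : Subgroup T) :=
        Nat.card_pos
      rw [hFcent]
      have h4 : 2 ^ 2 ≤ p ^ 2 := Nat.pow_le_pow_left hp.two_le 2
      nlinarith
    obtain ⟨n, m, hm, hle, j, hj, A, _, hA, hA', hit⟩ := ih _ hlt (GrpCat.of φ.CentralProduct) F hF
      (hcf.trans (by
        rintro _ ⟨x, rfl⟩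
        exact (hFr _).2 ⟨x, 1, by simp⟩))
      (by
        intro q hq
        obtain ⟨x, y, hxy⟩ := (hFr (F q)).1 ⟨q, rfl⟩
        -- A central element `f₀ x * f y` of the enlarged part: the two factors commute with each
        -- other's groups, so each is central in its own group and lies in `⟨c⟩`.
        have hq' : ∀ x' y', Commute (f₀ x * f y) (f₀ x' * f y') := by
          intro x' y'
          obtain ⟨q', hq'⟩ := (hFr (f₀ x' * f y')).2 ⟨x', y', rfl⟩
          rw [← hxy, ← hq']
          exact hq q'
        rw [hxy]
        apply mul_mem
        · apply hcenter
          intro x'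
          have h1 := hq' x' 1
          rw [map_one, mul_one] at h1
          have h2 : Commute (f y)⁻¹ (f₀ x') := ((hcommD x' _ (hfD ⟨y, rfl⟩)).inv_right).symm
          simpa using h1.mul_left h2
        · apply hfcen
          intro y'
          have h1 := hq' 1 y'
          rw [map_one, one_mul] at h1
          have h2 : Commute (f₀ x)⁻¹ (f y') := ((hcommD x _ (hfD ⟨y', rfl⟩)).inv_left)
          simpa using h2.mul_left h1)
      (by
        intro t
        obtain ⟨x, z, hz, rfl⟩ := hdec t
        obtain ⟨e, z', hz', rfl⟩ := hfdec z hz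
        obtain ⟨q, hq⟩ := (hFr (f₀ x * f e)).2 ⟨x, e, rfl⟩
        refine ⟨q, z', ?_, by rw [hq, mul_assoc]⟩
        rw [hFcent]
        exact hz') rfl
    refine ⟨n + 1, m, hm, ?_, Fin.cons j₀ j, ?_, A, _, hA, hA', ?_⟩
    · rw [hFcent] at hle
      calc p ^ (2 * (n + 1) + m) = p ^ 2 * p ^ (2 * n + m) := by ring
        _ ≤ _ := (Nat.mul_le_mul_left _ hle).trans (hN ▸ hfcard)
    · intro k
      refine Fin.cases ?_ ?_ k
      · exact ⟨hj₀, hγ⟩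
      · exact hj
    · rw [factorList_cons]
      exact ⟨φ, hmax, (hfin φ hφ).1, (hfin φ hφ).2, hit⟩
  · push Not at hD
    -- An abelian centralizer is the final factor `A`; no further `E` is needed, so `n = 0`.
    let _ : CommGroup D :=
      { (inferInstance : Group D) with mul_comm := fun x y => Subtype.ext (hD x x.2 y y.2) }
    obtain ⟨m, hm, hle, A, _, hA, hA', ⟨e⟩⟩ := exists_memA hp (D := D) (c := ⟨c, hcD⟩)
      (Subtype.ext h.pow_eq_one) (fun h1 => h.ne_one (congrArg Subtype.val h1))
      (fun x => by
        obtain ⟨l, hl⟩ := h.pow_mem x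
        exact ⟨l, Subtype.ext hl⟩)
    let f : A →* T := D.subtype.comp e.toMonoidHom
    have hfD : ∀ y, f y ∈ D := fun y => (e y).2
    obtain ⟨φ, hmax, hφ, F, hF, hFr⟩ := exists_centralIso f₀ f hinj
      (D.subtype_injective.comp e.injective) (Subgroup.zpowers c) hcen hcf
      (by
        rw [Subgroup.zpowers_le]
        exact ⟨e.symm ⟨c, hcD⟩, by simp [f]⟩)
      (fun x y => hcommD x _ (hfD y)) hcenter
    have hFs : Function.Surjective F := by
      intro t
      obtain ⟨x, z, hz, rfl⟩ := hdec t
      exact (hFr _).2 ⟨x, e.symm ⟨z, hz⟩, by simp [f]⟩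
    refine ⟨0, m, hm, ?_, Fin.elim0, fun k => k.elim0, A, _, hA, hA', ?_⟩
    · rw [← hN]; simpa using hle
    · exact ⟨φ, hmax, (hfin φ hφ).1, (hfin φ hφ).2, ⟨(MulEquiv.ofBijective F ⟨hF, hFs⟩).symm⟩⟩

theorem IsCommutatorGenerator.exists_isIteratedCentralProduct (h : IsCommutatorGenerator p c)
    (hp : p.Prime) [Finite T] (hT : ¬ ∀ x y : T, x * y = y * x) :
    ∃ n m, 0 < n ∧ 0 < m ∧ p ^ (2 * n + m) ≤ Nat.card T ∧ ∃ j : Fin n → ℕ,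
      (∀ k, (j k = 0 ∨ j k = 1) ∧ genC p (j k) ≠ 1) ∧
      ∃ (A : Type) (_ : CommGroup A), MemA m p A ∧
        (Nonempty (A ≃* Multiplicative (Fin m → ZMod p)) ∨
          Nonempty (A ≃* Multiplicative ((Fin (m - 1) → ZMod p) × ZMod (p ^ 2)))) ∧
        IsIteratedCentralProduct p T (factorList p j A) := by
  push Not at hT
  obtain ⟨x, y, hxy⟩ := hT
  -- The first `E` is split from all of `T` and starts the iteration; non-commutativity of `T` thus
  -- gives `0 < n`.
  obtain ⟨j₀, hj₀, hγ, f, hf, hcf, -, hfcen, hfdec, hfcard⟩ := h.exists_hom_E hp ⊤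
    ⟨x, trivial, y, trivial, hxy⟩
  rw [top_inf_eq] at hfcard hfdec
  obtain ⟨n, m, hm, hle, j, hj, A, _, hA, hA', hit⟩ := h.exists_iterated hp _
    (GrpCat.of (E p j₀)) f hf hcf hfcen (fun t => hfdec t trivial) rfl
  refine ⟨n + 1, m, n.succ_pos, hm, ?_, Fin.cons j₀ j, ?_, A, _, hA, hA', ?_⟩
  · calc p ^ (2 * (n + 1) + m) = p ^ 2 * p ^ (2 * n + m) := by ring
      _ ≤ _ := (Nat.mul_le_mul_left _ hle).trans (hfcard.trans (by simp))
  · intro k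
    refine Fin.cases ?_ ?_ k
    · exact ⟨hj₀, hγ⟩
    · exact hj
  · rw [factorList_cons]
    exact hit

end Decomposition

/-! ### Quotients of special groups and embeddings into products. -/

section Main

variable {p : ℕ}

/-- The Heisenberg group acts on the plane over `ZMod p`: `a` is a translation, `b` a shear, and
their commutator `c` a nontrivial translation. The abelian case needs this, having no Heisenberg
pair in `S` to use. -/
theorem genC_zero_ne_one (hp : p.Prime) : genC p 0 ≠ 1 := by
  have := Fact.mk hp
  let a : Equiv.Perm (ZMod p × ZMod p) :=
    ⟨fun v => (v.1 + 1, v.2), fun v => (v.1 - 1, v.2), fun v => by simp, fun v => by simp⟩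
  let b : Equiv.Perm (ZMod p × ZMod p) :=
    ⟨fun v => (v.1, v.2 + v.1), fun v => (v.1, v.2 - v.1), fun v => by simp, fun v => by simp⟩
  let c : Equiv.Perm (ZMod p × ZMod p) :=
    ⟨fun v => (v.1, v.2 - 1), fun v => (v.1, v.2 + 1), fun v => by simp, fun v => by simp⟩
  have ha : ∀ (n : ℕ) v, (a ^ n) v = (v.1 + n, v.2) := by
    intro n
    induction n with
    | zero => simp
    | succ n ih => intro v; rw [pow_succ', Equiv.Perm.mul_apply, ih]; simp [a, add_assoc]
  have hb : ∀ (n : ℕ) v, (b ^ n) v = (v.1, v.2 + n * v.1) := by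
    intro n
    induction n with
    | zero => simp
    | succ n ih =>
      intro v; rw [pow_succ', Equiv.Perm.mul_apply, ih]; simp only [b, Equiv.coe_fn_mk]
      ext <;> push_cast <;> ring
  have hc : ∀ (n : ℕ) v, (c ^ n) v = (v.1, v.2 - n) := by
    intro n
    induction n with
    | zero => simp
    | succ n ih => intro v; rw [pow_succ', Equiv.Perm.mul_apply, ih]; simp [c, sub_sub]
  let v : Gen → Equiv.Perm (ZMod p × ZMod p) := fun g => match g with
    | Gen.α => a
    | Gen.β => b
    | Gen.γ => c
  have hap : a ^ p = 1 := by ext w <;> simp [ha]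
  have hbp : b ^ p = 1 := by ext w <;> simp [hb]
  have hcp : c ^ p = 1 := by ext w <;> simp [hc]
  have hac : groupComm a c = 1 := groupComm_eq_one_iff.2 (by ext w <;> simp [a, c])
  have hbc : groupComm b c = 1 := groupComm_eq_one_iff.2 (by
    ext w <;> simp [b, c]; ring)
  have hab : groupComm a b = c := by
    have : a * b = b * a * c := by
      ext w <;> simp [a, b, c]
    rw [groupComm, mul_assoc, this]; group
  unfold groupComm at hac hbc hab
  have hv : ∀ r ∈ relators p 0, FreeGroup.lift v r = 1 := by
    rintro r (rfl | rfl | rfl | rfl | rfl | rfl) <;>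
      simp [groupComm, v, hap, hbp, hcp, hac, hbc, hab]
  intro h
  have h1 : PresentedGroup.toGroup hv (genC p 0) = c := PresentedGroup.toGroup.of hv
  rw [h, map_one] at h1
  have h2 := congrArg (fun f : Equiv.Perm (ZMod p × ZMod p) => (f (0, 0)).2) h1
  simp [c] at h2

/-- Bilinearity gives `[x ^ p, y] = [x, y] ^ p = 1`. -/
theorem pow_mem_center {G : Type*} [Group G] (hZ : ∀ z ∈ Subgroup.center G, z ^ p = 1)
    (hcomm : ∀ x y : G, ∃ z ∈ Subgroup.center G, x * y = y * x * z) (x : G) :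
    x ^ p ∈ Subgroup.center G := by
  rw [Subgroup.mem_center_iff]
  intro y
  obtain ⟨z, hz, h⟩ := hcomm x y
  have hc : ∀ g, Commute z g := fun g => (Subgroup.mem_center_iff.1 hz g).symm
  have h1 : CommBy z x y 1 := by rw [CommBy, zpow_one, h]
  have h2 := h1.pow_left hc p
  rw [CommBy, mul_one, zpow_natCast, hZ z hz, mul_one] at h2
  exact h2.symm

theorem exists_mem_center_of_commutator_le {G : Type*} [Group G]
    (h : commutator G ≤ Subgroup.center G) (x y : G) :
    ∃ z ∈ Subgroup.center G, x * y = y * x * z := by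
  refine ⟨(y * x)⁻¹ * (x * y), h ?_, by group⟩
  have := Subgroup.commutator_mem_commutator (Subgroup.mem_top x⁻¹) (Subgroup.mem_top y⁻¹)
  rw [commutatorElement_def, ← commutator_def] at this
  convert this using 1
  group

theorem isCommutatorGenerator_genC {j : ℕ} (hp : p.Prime) (h : genC p j ≠ 1) :
    IsCommutatorGenerator p (genC p j) := by
  have hcen := center_E hp h
  have hcomm := exists_mem_center_of_commutator_le (G := E p j)
    (by rw [commutator_E h, hcen])
  refine ⟨commute_genC p j, genC_pow p j, h, fun x y => ?_, fun x => ?_⟩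
  · obtain ⟨z, hz, hxy⟩ := hcomm x y
    rw [hcen] at hz
    obtain ⟨i, rfl⟩ := hz
    exact ⟨i, hxy⟩
  · rw [← hcen]
    refine pow_mem_center (fun z hz => ?_) hcomm x
    rw [hcen] at hz
    obtain ⟨i, rfl⟩ := hz
    dsimp only
    rw [← zpow_natCast, zpow_comm, zpow_natCast, genC_pow, one_zpow]

theorem IsIteratedCentralProductFrom.congr {d : ℕ} {H H' : Type*} [Group H] [Group H']
    (e : H' ≃* H) (l : List GrpCat.{0}) (G₀ : GrpCat.{0})
    (h : IsIteratedCentralProductFrom d H G₀ l) : IsIteratedCentralProductFrom d H' G₀ l := by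
  induction l generalizing G₀ with
  | nil => exact h.map e.trans
  | cons G₁ l ih =>
    obtain ⟨φ, h1, h2, h3, h4⟩ := h
    exact ⟨φ, h1, h2, h3, ih _ h4⟩

theorem IsIteratedCentralProduct.congr {d : ℕ} {H H' : Type*} [Group H] [Group H']
    (e : H' ≃* H) {l : List GrpCat.{0}} (h : IsIteratedCentralProduct d H l) :
    IsIteratedCentralProduct d H' l := by
  cases l with
  | nil =>
    have : Subsingleton H := h
    exact e.injective.subsingleton
  | cons G₀ l => exact IsIteratedCentralProductFrom.congr e l G₀ h

theorem exists_coordinates (hp : p.Prime) {Z : Type*} [CommGroup Z] [Finite Z]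
    (h : ∀ z : Z, z ^ p = 1) {s : ℕ} (hs : Nat.card Z = p ^ s) :
    ∃ π : Fin s → Z →* Multiplicative (ZMod p), (∀ z, (∀ i, π i z = 1) → z = 1) ∧
      ∀ i, ∃ z, π i z = Multiplicative.ofAdd 1 := by
  have := Fact.mk hp
  obtain ⟨m, ⟨e⟩⟩ := exists_addEquiv_pi (B := Additive Z) hp h
  obtain rfl : m = s := by
    have h1 : Nat.card Z = p ^ m := by
      rw [← Nat.card_congr Additive.ofMul.symm, Nat.card_congr e.toEquiv]; simp
    exact Nat.pow_right_injective hp.two_le (h1.symm.trans hs)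
  refine ⟨fun i => AddMonoidHom.toMultiplicativeRight
    ((Pi.evalAddMonoidHom (fun _ => ZMod p) i).comp e.toAddMonoidHom), ?_, ?_⟩
  · intro z hz
    have : e (Additive.ofMul z) = 0 := by
      ext i
      exact hz i
    exact (map_eq_zero_iff e e.injective).1 this
  · intro i
    refine ⟨(e.symm (Pi.single i 1)).toMul, ?_⟩
    change Multiplicative.ofAdd (e (e.symm (Pi.single i 1)) i) = _
    simp

theorem IsSpecial.frattini_conditions {S : Type*} [Group S] (hS : IsSpecial p S)
    (hne : ¬ ∀ x y : S, x * y = y * x) :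
    (∀ z ∈ Subgroup.center S, z ^ p = 1) ∧ Subgroup.center S = commutator S := by
  obtain ⟨-, -, h | ⟨h1, h2, h3⟩⟩ := hS
  · exact absurd h.1 hne
  · refine ⟨fun z hz => ?_, h2⟩
    rw [← h1] at hz
    exact congrArg Subtype.val (h3.2 ⟨z, hz⟩)

theorem IsSpecial.pow_eq_one_of_comm {S : Type*} [Group S] (hS : IsSpecial p S)
    (hcomm : ∀ x y : S, x * y = y * x) (x : S) : x ^ p = 1 := by
  obtain ⟨-, -, h | ⟨h1, h2, h3⟩⟩ := hS
  · exact h.2 x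
  · have hx : x ∈ frattini S := by
      rw [h1, Subgroup.mem_center_iff]
      exact fun g => hcomm g x
    exact congrArg Subtype.val (h3.2 ⟨x, hx⟩)

theorem IsSpecial.exists_isCommutatorGenerator {S : Type*} [Group S] (hp : p.Prime)
    (hS : IsSpecial p S) (hne : ¬ ∀ x y : S, x * y = y * x) {s : ℕ}
    (hs : Nat.card (Subgroup.center S) = p ^ s) :
    ∃ (K : Fin s → Subgroup S) (_ : ∀ i, (K i).Normal), (∀ i, K i ≤ Subgroup.center S) ∧
      (⨅ i, K i) = ⊥ ∧ ∀ i, (∃ c : S ⧸ K i, IsCommutatorGenerator p c) ∧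
        ¬ ∀ x y : S ⧸ K i, x * y = y * x := by
  have := Fact.mk hp
  have := hS.1
  obtain ⟨hZ, hcom⟩ := hS.frattini_conditions hne
  have hcomm := exists_mem_center_of_commutator_le hcom.ge
  have hpow := pow_mem_center hZ hcomm
  let _ : CommGroup (Subgroup.center S) :=
    { (inferInstance : Group (Subgroup.center S)) with mul_comm := mul_comm' }
  obtain ⟨π, hπ, hπs⟩ := exists_coordinates hp (Z := Subgroup.center S)
    (fun z => Subtype.ext (hZ z z.2)) hs
  let K : Fin s → Subgroup S := fun i => (π i).ker.map (Subgroup.center S).subtype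
  have hK : ∀ i x, x ∈ K i ↔ ∃ h : x ∈ Subgroup.center S, π i ⟨x, h⟩ = 1 := by
    intro i x
    simp only [K, Subgroup.mem_map, MonoidHom.mem_ker]
    constructor
    · rintro ⟨z, hz, rfl⟩
      exact ⟨z.2, hz⟩
    · rintro ⟨h, hx⟩
      exact ⟨⟨x, h⟩, hx, rfl⟩
  have hKZ : ∀ i, K i ≤ Subgroup.center S := fun i x hx => ((hK i x).1 hx).1
  have hnorm : ∀ i, (K i).Normal := fun i => ⟨fun n hn g => by
    rw [Subgroup.mem_center_iff.1 (hKZ i hn) g, mul_inv_cancel_right]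
    exact hn⟩
  refine ⟨K, hnorm, hKZ, ?_, ?_⟩
  -- For `s = 0` the empty intersection would be all of `S`; a trivial centre is excluded because it
  -- contains the commutators.
  · have hs0 : s ≠ 0 := by
      rintro rfl
      rw [pow_zero, Subgroup.card_eq_one] at hs
      refine hne fun x y => ?_
      obtain ⟨z, hz, hxy⟩ := hcomm x y
      rw [hs, Subgroup.mem_bot] at hz
      rw [hxy, hz, mul_one]
    rw [eq_bot_iff]
    intro x hx
    rw [Subgroup.mem_iInf] at hx
    obtain ⟨h, -⟩ := (hK _ x).1 (hx ⟨0, Nat.pos_of_ne_zero hs0⟩)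
    exact congrArg Subtype.val (hπ ⟨x, h⟩ fun i => ((hK i x).1 (hx i)).2)
  · intro i
    obtain ⟨z₀, hz₀⟩ := hπs i
    have hne1 : ((z₀ : S) : S ⧸ K i) ≠ 1 := by
      intro h
      rw [QuotientGroup.eq_one_iff] at h
      obtain ⟨h, h'⟩ := (hK i _).1 h
      change π i z₀ = 1 at h'
      rw [hz₀] at h'
      exact one_ne_zero (α := ZMod p) h'
    have hmem : ∀ z ∈ Subgroup.center S, ((z : S) : S ⧸ K i) ∈
        Subgroup.zpowers ((z₀ : S) : S ⧸ K i) := by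
      intro z hz
      obtain ⟨n, hn⟩ := ZMod.intCast_surjective (π i ⟨z, hz⟩).toAdd
      refine ⟨n, ?_⟩
      change (((z₀ : S) ^ n : S) : S ⧸ K i) = z
      rw [QuotientGroup.eq, hK]
      refine ⟨mul_mem (inv_mem (zpow_mem z₀.2 n)) hz, ?_⟩
      change π i ((z₀ ^ n)⁻¹ * ⟨z, hz⟩) = 1
      rw [map_mul, map_inv, map_zpow, hz₀, inv_mul_eq_one, ← ofAdd_toAdd (π i ⟨z, hz⟩), ← hn,
        ← ofAdd_zsmul]
      simp
    refine ⟨⟨((z₀ : S) : S ⧸ K i), ?_, ?_, hne1, ?_, ?_⟩, ?_⟩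
    · intro g
      obtain ⟨g, rfl⟩ := QuotientGroup.mk_surjective g
      exact congrArg (QuotientGroup.mk (s := K i)) (Subgroup.mem_center_iff.1 z₀.2 g).symm
    · rw [← QuotientGroup.mk_pow, hZ _ z₀.2, QuotientGroup.mk_one]
    · intro x y
      obtain ⟨x, rfl⟩ := QuotientGroup.mk_surjective x
      obtain ⟨y, rfl⟩ := QuotientGroup.mk_surjective y
      obtain ⟨z, hz, hxy⟩ := hcomm x y
      obtain ⟨n, hn⟩ := hmem z hz
      refine ⟨n, ?_⟩
      dsimp only at hn
      rw [CommBy, hn, ← QuotientGroup.mk_mul, hxy]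
      rfl
    · intro x
      obtain ⟨x, rfl⟩ := QuotientGroup.mk_surjective x
      exact hmem _ (hpow x)
    · intro hall
      -- If the quotient were abelian, `K i` would contain `[S, S]`, which is the whole centre,
      -- although the coordinate `π i` is nonzero on it.
      have hle : commutator S ≤ K i := by
        rw [commutator_def, Subgroup.commutator_le]
        intro x _ y _
        rw [← QuotientGroup.eq_one_iff, commutatorElement_def]
        change (x : S ⧸ K i) * y * (x : S ⧸ K i)⁻¹ * (y : S ⧸ K i)⁻¹ = 1
        rw [hall x y]
        group
      rw [← hcom] at hle
      exact hne1 ((QuotientGroup.eq_one_iff _).2 (hle z₀.2))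

theorem memS_of_isIteratedCentralProduct (hp : p.Prime) {G : Type*} [Group G] [Finite G] {n m : ℕ}
    {j : Fin n → ℕ} (hj : ∀ k, j k = 0 ∨ j k = 1) {A : Type} [CommGroup A] (hA : MemA m p A)
    (h : IsIteratedCentralProduct p G (factorList p j A)) : MemS n m G :=
  ⟨inferInstance, p, hp.pos, j, fun k => by
    have := hp.two_le
    rcases hj k with h | h <;> omega, A, inferInstance, hA, h⟩

theorem MemS.congr {n m : ℕ} {G G' : Type*} [Group G] [Group G'] (e : G' ≃* G) (h : MemS n m G) :
    MemS n m G' := by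
  obtain ⟨hfin, d, hd, j, hj, A, _, hA, h⟩ := h
  exact ⟨Finite.of_equiv _ e.symm.toEquiv, d, hd, j, hj, A, _, hA, h.congr e⟩

theorem memSProd_of_homs {I : Set (ℕ × ℕ)} {r : ℕ} {S : Type*} [Group S] (G : Fin r → GrpCat.{0})
    (hG : ∀ i, ∃ nm ∈ I, MemS nm.1 nm.2 (G i)) (q : ∀ i, S →* G i)
    (hq : ∀ x, (∀ i, q i x = 1) → x = 1) : MemSProd I r S := by
  refine ⟨G, hG, MonoidHom.pi q, ?_⟩
  rw [injective_iff_map_eq_one]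
  exact fun x hx => hq x fun i => congrFun hx i

/-- Each coordinate of `S` is sent into `⟨γ⟩` in its own copy of `E p 0`. Membership of `E p 0` in
the required class comes from applying the decomposition to `E p 0` itself. -/
theorem memSProd_of_comm (hp : p.Prime) {S : Type*} [Group S] (hS : IsSpecial p S) {r : ℕ}
    (hcard : Nat.card S = p ^ r) (hcomm : ∀ x y : S, x * y = y * x) :
    MemSProd {nm : ℕ × ℕ | 0 < nm.1 ∧ 0 < nm.2 ∧ 2 * nm.1 + nm.2 ≤ 3} r S := by
  have := Fact.mk hp
  have := hS.1
  have hγ := genC_zero_ne_one hp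
  have := finite_E hp hγ
  let _ : CommGroup S := { (inferInstance : Group S) with mul_comm := hcomm }
  obtain ⟨π, hπ, -⟩ := exists_coordinates hp (hS.pow_eq_one_of_comm hcomm) hcard
  obtain ⟨n, m, hn, hm, hle, j, hj, A, _, hA, -, hit⟩ :=
    (isCommutatorGenerator_genC hp hγ).exists_isIteratedCentralProduct hp
      (isExtraSpecial_E hp hγ).2.1
  rw [card_E hp hγ, Nat.pow_le_pow_iff_right hp.one_lt] at hle
  let g : ZMod p →+ Additive (E p 0) := ZMod.lift p ⟨zmultiplesHom _ (Additive.ofMul (genC p 0)), by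
    change genC p 0 ^ (p : ℤ) = 1
    rw [zpow_natCast, genC_pow]⟩
  have hg : Function.Injective g := by
    rw [ZMod.lift_injective]
    intro m hm
    rw [ZMod.intCast_zmod_eq_zero_iff_dvd]
    exact (zpow_eq_one_iff_dvd_of_prime hp (genC_pow p 0) hγ m).1 hm
  let g' : Multiplicative (ZMod p) →* E p 0 := AddMonoidHom.toMultiplicativeLeft g
  have hg' : Function.Injective g' := hg
  refine memSProd_of_homs (fun _ => GrpCat.of (E p 0)) (fun _ => ⟨(n, m), ⟨hn, hm, hle⟩,
    memS_of_isIteratedCentralProduct hp (fun k => (hj k).1) hA hit⟩) (fun i => g'.comp (π i))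
    fun x hx => hπ x fun i => hg' ?_
  rw [map_one]
  exact hx i

theorem memSProd_of_quotients {I : Set (ℕ × ℕ)} {r s : ℕ} (hsr : s ≤ r) {S : Type*} [Group S]
    [Finite S] (hs : 0 < s) (K : Fin s → Subgroup S) [∀ i, (K i).Normal] (hK : (⨅ i, K i) = ⊥)
    (hI : ∀ i, ∃ nm ∈ I, MemS nm.1 nm.2 (S ⧸ K i)) : MemSProd I r S := by
  let q : ∀ k, S →* GrpCat.of (Shrink.{0} (S ⧸ K k)) := fun k =>
    (Shrink.mulEquiv.symm.toMonoidHom).comp (QuotientGroup.mk' (K k))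
  -- The surplus `r - s` slots repeat the quotient by `K 0`; `Shrink` moves the finite quotients to
  -- the lowest universe.
  let t : Fin r → Fin s := fun i => if h : (i : ℕ) < s then ⟨i, h⟩ else ⟨0, hs⟩
  have ht : ∀ k, ∃ i, t i = k := fun k => ⟨⟨k, k.2.trans_le hsr⟩, by simp [t]⟩
  refine memSProd_of_homs (fun i => GrpCat.of (Shrink.{0} (S ⧸ K (t i)))) (fun i => ?_)
    (fun i => q (t i)) fun x hx => ?_
  · obtain ⟨nm, hnm, h⟩ := hI (t i)
    exact ⟨nm, hnm, h.congr Shrink.mulEquiv⟩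
  · rw [← Subgroup.mem_bot, ← hK, Subgroup.mem_iInf]
    intro k
    obtain ⟨i, rfl⟩ := ht k
    rw [← QuotientGroup.eq_one_iff]
    exact (map_eq_one_iff (Shrink.mulEquiv.symm : S ⧸ K (t i) ≃* Shrink.{0} (S ⧸ K (t i)))
      (MulEquiv.injective _)).1 (hx i)

end Main

end SpecialGroups

theorem lemma2p9 (p r : ℕ) (hp : p.Prime) (hr : 0 < r) (S : Type*) [Group S]
    (hS : SpecialGroups.IsSpecial p S) (hcard : Nat.card S = p ^ r) :
    SpecialGroups.MemSProd
      {nm : ℕ × ℕ | 0 < nm.1 ∧ 0 < nm.2 ∧ 2 * nm.1 + nm.2 ≤ max r 3} r S ∧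
    ((¬ ∀ x y : S, x * y = y * x) →
      ∀ s : ℕ, Nat.card (Subgroup.center S) = p ^ s →
        ∃ (K : Fin s → Subgroup S) (_ : ∀ i, (K i).Normal),
          (∀ i, K i ≤ Subgroup.center S) ∧ (⨅ i, K i) = ⊥ ∧
          ∀ i, ∃ n m : ℕ, 0 < n ∧ 0 < m ∧ 2 * n + m ≤ r ∧
            ∃ j : Fin n → ℕ,
              (∀ k, (j k = 0 ∨ j k = 1) ∧
                SpecialGroups.IsExtraSpecial p (SpecialGroups.E p (j k)) ∧
                Nat.card (SpecialGroups.E p (j k)) = p ^ 3) ∧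
              ∃ (A : Type) (_ : CommGroup A), SpecialGroups.MemA m p A ∧
                (Nonempty (A ≃* Multiplicative (Fin m → ZMod p)) ∨
                  Nonempty (A ≃* Multiplicative ((Fin (m - 1) → ZMod p) × ZMod (p ^ 2)))) ∧
                SpecialGroups.IsIteratedCentralProduct p (S ⧸ K i)
                  (SpecialGroups.factorList p j A)) := by
  have := Fact.mk hp
  have := hS.1
  have main : (¬ ∀ x y : S, x * y = y * x) →
      ∀ s : ℕ, Nat.card (Subgroup.center S) = p ^ s →
        ∃ (K : Fin s → Subgroup S) (_ : ∀ i, (K i).Normal),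
          (∀ i, K i ≤ Subgroup.center S) ∧ (⨅ i, K i) = ⊥ ∧
          ∀ i, ∃ n m : ℕ, 0 < n ∧ 0 < m ∧ 2 * n + m ≤ r ∧
            ∃ j : Fin n → ℕ,
              (∀ k, (j k = 0 ∨ j k = 1) ∧
                SpecialGroups.IsExtraSpecial p (SpecialGroups.E p (j k)) ∧
                Nat.card (SpecialGroups.E p (j k)) = p ^ 3) ∧
              ∃ (A : Type) (_ : CommGroup A), SpecialGroups.MemA m p A ∧
                (Nonempty (A ≃* Multiplicative (Fin m → ZMod p)) ∨
                  Nonempty (A ≃* Multiplicative ((Fin (m - 1) → ZMod p) × ZMod (p ^ 2)))) ∧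
                SpecialGroups.IsIteratedCentralProduct p (S ⧸ K i)
                  (SpecialGroups.factorList p j A) := by
    intro hne s hs
    obtain ⟨K, hKn, hKZ, hK, h⟩ := hS.exists_isCommutatorGenerator hp hne hs
    refine ⟨K, hKn, hKZ, hK, fun i => ?_⟩
    obtain ⟨⟨c, hc⟩, hab⟩ := h i
    obtain ⟨n, m, hn, hm, hle, j, hj, A, _, hA, hA', hit⟩ :=
      hc.exists_isIteratedCentralProduct hp hab
    have hle' : p ^ (2 * n + m) ≤ p ^ r :=
      hle.trans (hcard ▸ Nat.card_le_card_of_surjective _ (QuotientGroup.mk_surjective (s := K i)))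
    exact ⟨n, m, hn, hm, (Nat.pow_le_pow_iff_right hp.one_lt).1 hle', j, fun k => ⟨(hj k).1,
      SpecialGroups.isExtraSpecial_E hp (hj k).2, SpecialGroups.card_E hp (hj k).2⟩, A, _, hA, hA',
      hit⟩
  refine ⟨?_, main⟩
  by_cases hcomm : ∀ x y : S, x * y = y * x
  · obtain ⟨G, hG, hf⟩ := SpecialGroups.memSProd_of_comm hp hS hcard hcomm
    refine ⟨G, fun i => ?_, hf⟩
    obtain ⟨nm, ⟨h1, h2, h3⟩, h⟩ := hG i
    exact ⟨nm, ⟨h1, h2, h3.trans (le_max_right _ _)⟩, h⟩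
  · obtain ⟨s, hs⟩ := (hS.2.1.to_subgroup (Subgroup.center S)).exists_card_eq
    have hsr : s ≤ r := by
      rw [← Nat.pow_le_pow_iff_right hp.one_lt, ← hs, ← hcard]
      exact Subgroup.card_le_card_group _
    obtain ⟨K, hKn, -, hK, h⟩ := main hcomm s hs
    -- An empty family would have intersection `⊤`, forcing `S` to be trivial.
    have hs0 : 0 < s := by
      rcases Nat.eq_zero_or_pos s with rfl | hpos
      · rw [iInf_of_empty] at hK
        exact absurd (fun x y => (Subgroup.subsingleton_iff.1
          (subsingleton_of_bot_eq_top hK.symm)).elim _ _) hcomm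
      · exact hpos
    refine SpecialGroups.memSProd_of_quotients hsr hs0 K hK fun i => ?_
    obtain ⟨n, m, hn, hm, hle, j, hj, A, _, hA, -, hit⟩ := h i
    exact ⟨(n, m), ⟨hn, hm, hle.trans (le_max_left _ _)⟩,
      SpecialGroups.memS_of_isIteratedCentralProduct hp (fun k => (hj k).1) hA hit⟩
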